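/- **Theorem (Regret Lower Bound).** *Setting.* A Markov decision process (MDP) has a state space $\mathcal S$, an action space $\mathcal A$, an initial state $s_1$ and i.i.d. exogenous noise $\xi_1,\xi_2,\dots$; action $a$ in state $s$ at step $t$ incurs the cost $C(s,a)=\mathrm{cost}(s,a,\xi_t)\in[0,1]$ and leads to the state $\mathrm{next}(s,a,\xi_t)$, so that the transition kernel and the stochastic cost are the laws of these variables. A finite policy class is a finite set $\Theta\subset\mathbb R^d$ with stationary deterministic policies $\pi_\theta:\mathcal S\to\mathcal A$, pairwise distinct. For a policy $\theta$ let $$g_\theta(s)=\lim_{T\to\infty}\tfrac1T\,\mathbb E\Big[\sum_{t\le T}C(S_t,A_t)\,\Big|\,S_1=s\Big],\qquad v_\theta(s)=\lim_{T\to\infty}\mathbb E\Big[\sum_{t\le T}\big(C(S_t,A_t)-g_\theta(S_t)\big)\,\Big|\,S_1=s\Big].$$ Let $\mathcal H^T_\theta=\{(S_t,A_t,C(S_t,A_t),S_{t+1})\}_{t\le T}$ be the sample path of $\pi_\theta$ from $s_1$ (all policies being driven by the same noise sequence) and let $G_\theta(\mathcal H^T_\theta)$ be its empirical average cost. The sample-path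 policy order is: $\pi_{\theta'}\preceq\pi_\theta$ iff for all $T\ge1$ the variable $G_{\theta'}(\mathcal H^T_{\theta'})$ is measurable with respect to $\sigma(\mathcal H^T_\theta)$. Its width is the largest size of a subset of $\Theta$ in which no two distinct elements are related. A (randomized) algorithm chooses $\theta_t\in\Theta$ at each step from its internal randomness, the transitions $(S_i,A_i,C_i,S_{i+1})$, $i<t$, observed so far, and $S_t$, and plays $A_t=\pi_{\theta_t}(S_t)$; it may depend on $T$. Its regret is $\mathsf{Regret}(T)=\sum_{t=1}^T C(S_t,A_t)-T\min_{\theta\in\Theta}g_\theta(s_1)$. *Assumptions.* (1) $\Theta$ is bounded. (2) Some $\theta_R\in\Theta$ reaches $s_1$ from every state in expected time at most some $D_\Theta\in\mathbb N^+$. (3) For every $\theta\in\Theta$ the limits $g_\theta$ and $v_\theta$ exist, $g_\theta(s)=g_\theta$ does not depend on $s$, $\max_{s,s'}|v_\theta(s)-v_\theta(s')|\le H$, and $\theta\mapsto g_\theta$ is Lipschitz for the sup norm. *Claim.* There is an absolute constant $c>0$ such that the following holds for all integers $1\le w\le n$ and every real $0<H\le n$. Put $B=\log n$ if $w=1$ and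 $B=w$ if $w>1$. There are finite $\mathcal S$, $\mathcal A$ and noise space, functions $\mathrm{next}$ and $\mathrm{cost}$, an initial state $s_1$ and a policy class $\Theta$ with $|\Theta|=n$, all of which the algorithm may know, whose sample-path policy order is a preorder of width exactly $w$, such that for every $T\ge\max\{1,H\}\cdot\max\{1,B\}$ and every algorithm there is a law of the noise (hence an MDP) for which Assumptions (1)–(3) hold and $$\mathbb E[\mathsf{Regret}(T)]\;\ge\;c\sqrt{H\,B\,T}=\begin{cases}c\sqrt{H\log(|\Theta|)\,T}, & w=1,\\ c\sqrt{H\,w\,T}, & w>1.\end{cases}$$ -/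

import Mathlib

open MeasureTheory Filter Topology
open scoped ENNReal NNReal

/-- The part of a Markov decision process that does not involve probabilities: state space `S`,
action space `A`, initial state `init`, and, for an exogenous noise value `x : Ξ`, the next state
`next s a x` and the realized cost `cost s a x ∈ [0, 1]` of action `a` in state `s`. -/
structure Dynamics (S A Ξ : Type) [MeasurableSpace S] [MeasurableSpace A] [MeasurableSpace Ξ] where
  next : S → A → Ξ → S
  cost : S → A → Ξ → ℝ
  init : S
  cost_mem : ∀ s a x, cost s a x ∈ Set.Icc (0 : ℝ) 1
  measurable_next : Measurable fun p : S × A × Ξ => next p.1 p.2.1 p.2.2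
  measurable_cost : Measurable fun p : S × A × Ξ => cost p.1 p.2.1 p.2.2

/-- A Markov decision process with stochastic costs. At every step a fresh noise value with law
`noise` is drawn independently; the transition kernel `P(· | s, a)` is the law of `next s a` and
the stochastic cost `C(s, a)` is the random variable `cost s a`. The common noise realizes the
trajectories of all policies on one probability space. -/
structure MDP (S A Ξ : Type) [MeasurableSpace S] [MeasurableSpace A] [MeasurableSpace Ξ]
    extends Dynamics S A Ξ where
  noise : Measure Ξ
  isProbabilityMeasure_noise : IsProbabilityMeasure noise

attribute [instance] MDP.isProbabilityMeasure_noise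

/-- One entry `(S_t, A_t, C(S_t, A_t), S_{t+1})` of a sample path. -/
abbrev Transition (S A : Type) : Type := S × A × ℝ × S

/-- The cost recorded in an entry of a sample path. -/
def Transition.cost {S A : Type} (x : Transition S A) : ℝ := x.2.2.1

/-- A (randomized, history dependent) learning algorithm: before the interaction it draws a seed;
at time `t` it picks a policy parameter from the seed, the sample path observed so far and the
current state. -/
structure Algorithm (S A Θ : Type) [MeasurableSpace S] [MeasurableSpace A] [MeasurableSpace Θ] where
  Seed : Type
  measurableSpaceSeed : MeasurableSpace Seed
  law : Measure Seed
  isProbabilityMeasure_law : IsProbabilityMeasure law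
  choose : (t : ℕ) → Seed → (Fin t → Transition S A) → S → Θ
  measurable_choose : ∀ t : ℕ, Measurable
    fun p : Seed × (Fin t → Transition S A) × S => choose t p.1 p.2.1 p.2.2

attribute [instance] Algorithm.measurableSpaceSeed Algorithm.isProbabilityMeasure_law

section Deterministic

variable {S A Ξ Θ : Type} [MeasurableSpace S] [MeasurableSpace A] [MeasurableSpace Ξ]

/-- The state after `t` steps of the stationary policy `p`, started in `s` and driven by the noise
sequence `ξ`. -/
def Dynamics.stateAt (E : Dynamics S A Ξ) (p : S → A) (s : S) (ξ : ℕ → Ξ) : ℕ → S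
  | 0 => s
  | t + 1 => E.next (E.stateAt p s ξ t) (p (E.stateAt p s ξ t)) (ξ t)

/-- The cost incurred at step `t` (counted from `0`) under the stationary policy `p` started
in `s`. -/
def Dynamics.costAt (E : Dynamics S A Ξ) (p : S → A) (s : S) (ξ : ℕ → Ξ) (t : ℕ) : ℝ :=
  E.cost (E.stateAt p s ξ t) (p (E.stateAt p s ξ t)) (ξ t)

/-- The sample path of length `T` under the stationary policy `p`, started in the initial state. -/
def Dynamics.samplePath (E : Dynamics S A Ξ) (p : S → A) (T : ℕ) (ξ : ℕ → Ξ) :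
    Fin T → Transition S A :=
  fun t => (E.stateAt p E.init ξ t, p (E.stateAt p E.init ξ t), E.costAt p E.init ξ t,
    E.stateAt p E.init ξ (t + 1))

/-- The empirical average cost of a sample path of length `T`. -/
noncomputable def empiricalCost {T : ℕ} (h : Fin T → Transition S A) : ℝ :=
  (∑ t, (h t).cost) / T

/-- The sample-path policy order `π_θ' ⪯ π_θ`: for every length `T ≥ 1` the empirical average cost
under `θ'` is measurable with respect to the σ-algebra generated by the sample path under `θ`. -/
def Dynamics.SamplePathLE (E : Dynamics S A Ξ) (π : Θ → S → A) (θ' θ : Θ) : Prop :=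
  ∀ T : ℕ, 1 ≤ T →
    Measurable[MeasurableSpace.comap (E.samplePath (π θ) T) inferInstance]
      fun ξ : ℕ → Ξ => empiricalCost (E.samplePath (π θ') T ξ)

/-- `w` is the width of `r`: the largest size of a finite set of pairwise `r`-unrelated elements. -/
def HasWidth (r : Θ → Θ → Prop) (w : ℕ) : Prop :=
  IsGreatest {k : ℕ | ∃ s : Finset Θ, s.card = k ∧ IsAntichain r (s : Set Θ)} w

/-- The first `t` steps of the interaction of an algorithm, with seed `u`, with the system driven
by the noise `ξ`: the sample path so far and the current state. -/
def Dynamics.interact [MeasurableSpace Θ] (E : Dynamics S A Ξ) (π : Θ → S → A)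
    (alg : Algorithm S A Θ) (u : alg.Seed) (ξ : ℕ → Ξ) : (t : ℕ) → (Fin t → Transition S A) × S
  | 0 => (Fin.elim0, E.init)
  | t + 1 =>
    let h := (E.interact π alg u ξ t).1
    let s := (E.interact π alg u ξ t).2
    let a := π (alg.choose t u h s) s
    (Fin.snoc (α := fun _ => Transition S A) h (s, a, E.cost s a (ξ t), E.next s a (ξ t)),
      E.next s a (ξ t))

end Deterministic

namespace MDP

variable {S A Ξ Θ : Type} [MeasurableSpace S] [MeasurableSpace A] [MeasurableSpace Ξ]

/-- The law of the sequence of i.i.d. noise values. -/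
noncomputable def noiseSeq (M : MDP S A Ξ) : Measure (ℕ → Ξ) :=
  Measure.infinitePi fun _ : ℕ => M.noise

/-- `(1 / T) E[∑_{t ≤ T} C(S_t, A_t) | S_1 = s]` under the policy `p`. -/
noncomputable def meanCost (M : MDP S A Ξ) (p : S → A) (s : S) (T : ℕ) : ℝ :=
  (∫ ξ, ∑ t ∈ Finset.range T, M.costAt p s ξ t ∂M.noiseSeq) / T

/-- The long-run average cost `g(s)` of the policy `p`. -/
noncomputable def avgCost (M : MDP S A Ξ) (p : S → A) (s : S) : ℝ :=
  limUnder atTop (M.meanCost p s)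

/-- `E[∑_{t ≤ T} (C(S_t, A_t) - g(S_t)) | S_1 = s]` under the policy `p`. -/
noncomputable def relativeCost (M : MDP S A Ξ) (p : S → A) (s : S) (T : ℕ) : ℝ :=
  ∫ ξ, ∑ t ∈ Finset.range T,
    (M.costAt p s ξ t - M.avgCost p (M.stateAt p s ξ t)) ∂M.noiseSeq

/-- The bias `v(s)` of the policy `p`. -/
noncomputable def bias (M : MDP S A Ξ) (p : S → A) (s : S) : ℝ :=
  limUnder atTop (M.relativeCost p s)

/-- The expected number of steps that the policy `p` needs to reach the initial state from `s`. -/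
noncomputable def expectedReturn (M : MDP S A Ξ) (p : S → A) (s : S) : ℝ≥0∞ :=
  ∫⁻ ξ, ⨅ (t : ℕ) (_ : M.stateAt p s ξ t = M.init), (t : ℝ≥0∞) ∂M.noiseSeq

/-- Some policy of the class returns to the initial state, from every state, in bounded expected
time. -/
def RestartAssumption (M : MDP S A Ξ) (π : Θ → S → A) : Prop :=
  ∃ θR : Θ, ∃ D : ℕ, 0 < D ∧ ∀ s : S, M.expectedReturn (π θR) s ≤ D

/-- For every policy of the class the average cost exists and does not depend on the starting
state, the bias exists and has span at most `H`, and the average cost is Lipschitz in the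
parameter. -/
structure GainBiasAssumption [PseudoEMetricSpace Θ] (M : MDP S A Ξ) (π : Θ → S → A) (H : ℝ) :
    Prop where
  tendsto_avgCost : ∀ θ s, Tendsto (M.meanCost (π θ) s) atTop (𝓝 (M.avgCost (π θ) s))
  avgCost_uniform : ∀ θ s, M.avgCost (π θ) s = M.avgCost (π θ) M.init
  tendsto_bias : ∀ θ s, Tendsto (M.relativeCost (π θ) s) atTop (𝓝 (M.bias (π θ) s))
  bias_span : ∀ θ s s', |M.bias (π θ) s - M.bias (π θ) s'| ≤ H
  lipschitz : ∃ L : ℝ≥0, LipschitzWith L fun θ => M.avgCost (π θ) M.init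

/-- The regret after `T` steps, against the best policy of the class, when the algorithm has
seed `u` and the noise sequence is `ξ`. -/
noncomputable def regret [MeasurableSpace Θ] (M : MDP S A Ξ) (π : Θ → S → A)
    (alg : Algorithm S A Θ) (T : ℕ) (u : alg.Seed) (ξ : ℕ → Ξ) : ℝ :=
  ∑ t, ((M.interact π alg u ξ T).1 t).cost - T * ⨅ θ : Θ, M.avgCost (π θ) M.init

/-- The expected regret, over the seed of the algorithm and the independent noise. -/
noncomputable def expectedRegret [MeasurableSpace Θ] (M : MDP S A Ξ) (π : Θ → S → A)
    (alg : Algorithm S A Θ) (T : ℕ) : ℝ :=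
  ∫ q, M.regret π alg T q.1 q.2 ∂(alg.law.prod M.noiseSeq)

end MDP

/-- The parameter set is bounded in the sup norm. -/
def BoundedAssumption {d : ℕ} (Θ : Finset (Fin d → ℝ)) : Prop :=
  ∃ U : ℝ, ∀ θ ∈ Θ, ‖θ‖ ≤ U

/-- `log n` for width `w = 1` and `w` for larger width. -/
noncomputable def complexity (w n : ℕ) : ℝ :=
  if w = 1 then Real.log n else w

/-!
The hard instance is a *lazy bandit*. Its state is a cost level in `{0, 1}`, which is also the cost
incurred. At each step the noise decides, with probability `p = 1 / max 1 H`, whether the action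
takes effect; if so, the level becomes a fresh random level of the arm selected by the action, and
otherwise it stays. Under a constant policy the expected level is pulled at rate `p` towards the
mean of its arm, so the gain is this mean and the bias has span `1 / p - 1 ≤ H`
(`gainBiasAssumption_lazyMDP`). One noise value of positive probability leads from every state to
the initial one, which bounds the expected return time (`restartAssumption_lazyMDP`).

The same pull, summed over time, shows that the regret is the regret of the arms played plus
`(1 / p - 1)` times the drop of the expected level; as the initial level is the worst one, this
drop is nonnegative (`sum_playProb_le_integral_regret`). Hence it suffices to bound how often an
algorithm can play a good arm, of mean `(1 - δ) / 2`, hidden among arms of mean `1 / 2`, when a step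
is informative with probability `p` only. The seed is fixed and the position of the good arm is
averaged over (`exists_expectedRegret_ge`).

* For width `1` the next state reveals the whole noise value, so that every policy determines the
  costs of all others, and each of the `n` policies has its own arm. Each likelihood ratio has
  second moment at most `(1 + p δ²)ᵀ ≤ exp (p δ² T)`, and the events of playing the different arms
  are disjoint. By the Cauchy–Schwarz inequality the good arm is played with average probability
  bounded away from `1` when `p δ² T = log n / 2` (`exists_expectedRegret_ge_log`).
* For width `w > 1` only the level is revealed, and the `n` policies are distributed over `w` arms,
  so that policies are related exactly if they use the same arm (`lazyBandit_samplePathLE_iff`).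
  The relative entropy of the observations is at most `p δ²` times the expected number of plays of
  the good arm under the unbiased noise; these numbers add up to `T`, so `p δ² T` of order `w`
  leaves the good arm hidden (`exists_expectedRegret_ge_of_bandit`).

In both cases the regret is of order `δ T`, that is, `√(B T / p) ≥ √(H B T)`.
-/

/-! ### Functions of finitely many noise values -/

section IIDNoise

theorem exists_eq_comp_restrict_of_dependsOn {Ξ β : Type} [Nonempty Ξ] {t : ℕ} {f : (ℕ → Ξ) → β}
    (hf : DependsOn f (Set.Iio t)) :
    ∃ g : (Finset.range t → Ξ) → β, f = g ∘ (Finset.range t).restrict := by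
  classical
  refine ⟨fun r => f fun i => if h : i ∈ Finset.range t then r ⟨i, h⟩ else Classical.arbitrary Ξ, ?_⟩
  funext ξ
  refine hf fun i hi => ?_
  have : i ∈ Finset.range t := Finset.mem_range.2 hi
  simp [Finset.restrict, Finset.mem_range.1 this]

variable {Ξ : Type} [MeasurableSpace Ξ] [Finite Ξ] [MeasurableSingletonClass Ξ]

theorem integrable_of_dependsOn {t : ℕ} {f : (ℕ → Ξ) → ℝ} (hf : DependsOn f (Set.Iio t))
    (P : Measure (ℕ → Ξ)) [IsFiniteMeasure P] : Integrable f P := by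
  rcases isEmpty_or_nonempty Ξ with h | h
  · have : IsEmpty (ℕ → Ξ) := ⟨fun ξ => h.elim (ξ 0)⟩
    have hP : P = 0 := Measure.eq_zero_of_isEmpty P
    simp [hP]
  obtain ⟨g, rfl⟩ := exists_eq_comp_restrict_of_dependsOn hf
  exact (Integrable.of_finite (μ := P.map (Finset.range t).restrict) (f := g)).comp_measurable
    (Finset.measurable_restrict _)

theorem integral_eval_of_dependsOn (ν : Measure Ξ) [IsProbabilityMeasure ν] {t : ℕ}
    {G : (ℕ → Ξ) → Ξ → ℝ} (hG : DependsOn G (Set.Iio t)) :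
    ∫ ξ, G ξ (ξ t) ∂(Measure.infinitePi fun _ : ℕ => ν) =
      ∫ ξ, ∫ x, G ξ x ∂ν ∂(Measure.infinitePi fun _ : ℕ => ν) := by
  have : Nonempty Ξ := nonempty_of_isProbabilityMeasure ν
  set P := Measure.infinitePi fun _ : ℕ => ν with hP
  obtain ⟨g, rfl⟩ := exists_eq_comp_restrict_of_dependsOn hG
  have hind : ProbabilityTheory.IndepFun (Finset.range t).restrict (fun ξ : ℕ → Ξ => ξ t) P := by
    have h1 : ProbabilityTheory.iIndepFun (fun (i : ℕ) (ξ : ℕ → Ξ) => ξ i) P :=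
      ProbabilityTheory.iIndepFun_infinitePi (X := fun _ => id) (fun _ => measurable_id)
    exact (h1.indepFun_finset (Finset.range t) {t} (by simp) (fun i => measurable_pi_apply i)).comp
      measurable_id (measurable_pi_apply (⟨t, by simp⟩ : ({t} : Finset ℕ)))
  have hm1 : Measurable ((Finset.range t).restrict : (ℕ → Ξ) → _) := Finset.measurable_restrict _
  have hm2 : Measurable (fun ξ : ℕ → Ξ => ξ t) := measurable_pi_apply t
  have hmap := (ProbabilityTheory.indepFun_iff_map_prod_eq_prod_map_map hm1.aemeasurable
    hm2.aemeasurable).1 hind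
  have hν : P.map (fun ξ : ℕ → Ξ => ξ t) = ν := by
    rw [hP]; exact (measurePreserving_eval_infinitePi (fun _ : ℕ => ν) t).map_eq
  have : IsProbabilityMeasure (P.map ((Finset.range t).restrict : (ℕ → Ξ) → _)) :=
    Measure.isProbabilityMeasure_map hm1.aemeasurable
  calc ∫ ξ, (g ∘ (Finset.range t).restrict) ξ (ξ t) ∂P
      = ∫ z, g z.1 z.2 ∂(P.map fun ξ => ((Finset.range t).restrict ξ, ξ t)) := by
        rw [integral_map (hm1.prodMk hm2).aemeasurable
          (measurable_of_finite _).aestronglyMeasurable]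
        rfl
    _ = ∫ r, ∫ x, g r x ∂ν ∂(P.map (Finset.range t).restrict) := by
        rw [hmap, hν, integral_prod _ Integrable.of_finite]
    _ = _ := by
        rw [integral_map hm1.aemeasurable (measurable_of_finite _).aestronglyMeasurable]
        rfl

end IIDNoise

/-! ### Change of measure for adaptive processes -/

section Adaptive

variable {Ξ : Type} {𝓗 : ℕ → Type}

/-- The state at time `t` of a process that starts in `h0` and is updated at time `t` by the noise
value `ξ t`. The type of the state may depend on the time, so that histories are covered. -/
def run (h0 : 𝓗 0) (step : ∀ t, 𝓗 t → Ξ → 𝓗 (t + 1)) (ξ : ℕ → Ξ) : ∀ t, 𝓗 t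
  | 0 => h0
  | t + 1 => step t (run h0 step ξ t) (ξ t)

/-- The product over the first `t` steps of the likelihood ratios `ℓ` of one step, evaluated along
the process `run h0 step`. -/
def likelihood (h0 : 𝓗 0) (step : ∀ t, 𝓗 t → Ξ → 𝓗 (t + 1)) (ℓ : ∀ t, 𝓗 t → Ξ → ℝ)
    (ξ : ℕ → Ξ) : ℕ → ℝ
  | 0 => 1
  | t + 1 => likelihood h0 step ℓ ξ t * ℓ t (run h0 step ξ t) (ξ t)

variable {h0 : 𝓗 0} {step : ∀ t, 𝓗 t → Ξ → 𝓗 (t + 1)} {ℓ : ∀ t, 𝓗 t → Ξ → ℝ}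

theorem run_congr {ξ ξ' : ℕ → Ξ} :
    ∀ {t : ℕ}, (∀ i < t, ξ i = ξ' i) → run h0 step ξ t = run h0 step ξ' t
  | 0, _ => rfl
  | t + 1, h => by
    rw [run, run, run_congr fun i hi => h i (hi.trans t.lt_succ_self), h t t.lt_succ_self]

theorem likelihood_congr {ξ ξ' : ℕ → Ξ} :
    ∀ {t : ℕ}, (∀ i < t, ξ i = ξ' i) → likelihood h0 step ℓ ξ t = likelihood h0 step ℓ ξ' t
  | 0, _ => rfl
  | t + 1, h => by
    have h' : ∀ i < t, ξ i = ξ' i := fun i hi => h i (hi.trans t.lt_succ_self)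
    rw [likelihood, likelihood, likelihood_congr h', run_congr h', h t t.lt_succ_self]

theorem likelihood_pos (hℓ : ∀ t h x, 0 < ℓ t h x) (ξ : ℕ → Ξ) :
    ∀ t, 0 < likelihood h0 step ℓ ξ t
  | 0 => one_pos
  | t + 1 => mul_pos (likelihood_pos hℓ ξ t) (hℓ _ _ _)

/-- A function of the state and of the likelihood ratio at time `t` depends only on the noise
before time `t`. -/
theorem dependsOn_run_likelihood {β : Type} (t : ℕ) (f : 𝓗 t → ℝ → β) :
    DependsOn (fun ξ => f (run h0 step ξ t) (likelihood h0 step ℓ ξ t)) (Set.Iio t) := by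
  intro ξ ξ' h
  have h' : ∀ i < t, ξ i = ξ' i := fun i hi => h i hi
  simp only [run_congr h', likelihood_congr h']

theorem dependsOn_run {β : Type} (t : ℕ) (f : 𝓗 t → β) :
    DependsOn (fun ξ => f (run h0 step ξ t)) (Set.Iio t) := fun ξ ξ' h => by
  simp only [run_congr (h0 := h0) (step := step) (t := t) fun i hi => h i hi]

variable [MeasurableSpace Ξ] [Finite Ξ] [MeasurableSingletonClass Ξ]
variable {ν ν' : Measure Ξ} [IsProbabilityMeasure ν] [IsProbabilityMeasure ν']

/-- Change of measure for adaptive processes: if, from every state, `ℓ` turns the law of the next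
state under `ν` into its law under `ν'`, then the product of the `ℓ` along the process is a density
of the law under `ν'` of the state at time `t` with respect to its law under `ν`. -/
theorem integral_run_eq_integral_likelihood_mul
    (hℓ : ∀ t h (φ : 𝓗 (t + 1) → ℝ),
      ∫ x, φ (step t h x) ∂ν' = ∫ x, ℓ t h x * φ (step t h x) ∂ν) :
    ∀ (t : ℕ) (φ : 𝓗 t → ℝ),
      ∫ ξ, φ (run h0 step ξ t) ∂(Measure.infinitePi fun _ : ℕ => ν') =
        ∫ ξ, likelihood h0 step ℓ ξ t * φ (run h0 step ξ t) ∂(Measure.infinitePi fun _ : ℕ => ν)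
  | 0, φ => by simp [run, likelihood]
  | t + 1, φ => by
    have hd : DependsOn (fun (ξ : ℕ → Ξ) (x : Ξ) => φ (step t (run h0 step ξ t) x)) (Set.Iio t) :=
      dependsOn_run t fun h x => φ (step t h x)
    have hd' : DependsOn (fun (ξ : ℕ → Ξ) (x : Ξ) => likelihood h0 step ℓ ξ t *
        ℓ t (run h0 step ξ t) x * φ (step t (run h0 step ξ t) x)) (Set.Iio t) :=
      dependsOn_run_likelihood t fun h l x => l * ℓ t h x * φ (step t h x)
    simp only [run, likelihood]
    rw [integral_eval_of_dependsOn ν' hd, integral_eval_of_dependsOn ν hd']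
    simp only [mul_assoc, integral_const_mul]
    simp only [hℓ]
    exact integral_run_eq_integral_likelihood_mul hℓ t
      fun h => ∫ x, ℓ t h x * φ (step t h x) ∂ν

theorem integral_likelihood
    (hℓ : ∀ t h (φ : 𝓗 (t + 1) → ℝ),
      ∫ x, φ (step t h x) ∂ν' = ∫ x, ℓ t h x * φ (step t h x) ∂ν) (t : ℕ) :
    ∫ ξ, likelihood h0 step ℓ ξ t ∂(Measure.infinitePi fun _ : ℕ => ν) = 1 := by
  simpa using (integral_run_eq_integral_likelihood_mul (h0 := h0) hℓ t fun _ => 1).symm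

theorem integral_likelihood_sq {c : ℝ} (hc : ∀ t h, ∫ x, ℓ t h x ^ 2 ∂ν = c) :
    ∀ t : ℕ,
      ∫ ξ, likelihood h0 step ℓ ξ t ^ 2 ∂(Measure.infinitePi fun _ : ℕ => ν) = c ^ t
  | 0 => by simp [likelihood]
  | t + 1 => by
    simp only [likelihood, mul_pow]
    rw [integral_eval_of_dependsOn ν
      (G := fun ξ x => likelihood h0 step ℓ ξ t ^ 2 * ℓ t (run h0 step ξ t) x ^ 2)
      (dependsOn_run_likelihood t fun h l x => l ^ 2 * ℓ t h x ^ 2)]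
    simp only [integral_const_mul, hc, integral_mul_const]
    rw [integral_likelihood_sq hc t, pow_succ]

/-- Chain rule for the relative entropy of adaptive processes. -/
theorem integral_log_likelihood (hpos : ∀ t h x, 0 < ℓ t h x) :
    ∀ t : ℕ,
      ∫ ξ, Real.log (likelihood h0 step ℓ ξ t) ∂(Measure.infinitePi fun _ : ℕ => ν) =
        ∑ i ∈ Finset.range t, ∫ ξ, ∫ x, Real.log (ℓ i (run h0 step ξ i) x) ∂ν
          ∂(Measure.infinitePi fun _ : ℕ => ν)
  | 0 => by simp [likelihood]
  | t + 1 => by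
    have hd : DependsOn (fun (ξ : ℕ → Ξ) (x : Ξ) => Real.log (ℓ t (run h0 step ξ t) x))
        (Set.Iio t) := dependsOn_run t fun h x => Real.log (ℓ t h x)
    simp only [likelihood]
    simp only [Real.log_mul (likelihood_pos hpos _ t).ne' (hpos _ _ _).ne']
    rw [integral_add, Finset.sum_range_succ, integral_log_likelihood hpos t,
      integral_eval_of_dependsOn ν hd]
    · exact integrable_of_dependsOn
        (dependsOn_run_likelihood (h0 := h0) (step := step) (ℓ := ℓ) t fun _ l => Real.log l) _
    · refine integrable_of_dependsOn (t := t + 1) (fun ξ ξ' h => ?_) _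
      simp only [run_congr (h0 := h0) (step := step) (t := t)
        fun i hi => h i (Nat.lt_succ_of_lt hi), h t (Nat.lt_succ_self t)]

/-- The pointwise inequality behind the bandit bound, by way of the Hellinger distance. For
`r = √L` and `λ = 1 / 16` it follows from `(r - 1) (r + 1) ≤ (r - 1)² / (2 λ) + λ (r + 1)² / 2`,
`(r - 1)² ≤ L - 1 - log L` and `(r + 1)² ≤ 2 (L + 1)`. -/
theorem mul_sub_one_le_log {f L : ℝ} (hf0 : 0 ≤ f) (hf1 : f ≤ 1) (hL : 0 < L) :
    f * (L - 1) ≤ 8 * (L - 1 - Real.log L) + (L + 1) / 16 := by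
  obtain ⟨r, hr, rfl⟩ : ∃ r : ℝ, 0 < r ∧ L = r ^ 2 :=
    ⟨√L, Real.sqrt_pos.2 hL, (Real.sq_sqrt hL.le).symm⟩
  have h1 : Real.log (r ^ 2) ≤ 2 * (r - 1) := by
    rw [Real.log_pow]; push_cast
    linarith [Real.log_le_sub_one_of_pos hr]
  have h2 : f * (r ^ 2 - 1) ≤ 8 * (r - 1) ^ 2 + (r ^ 2 + 1) / 16 := by
    rcases le_total 1 r with h | h
    · have : f * (r ^ 2 - 1) ≤ 1 * (r ^ 2 - 1) :=
        mul_le_mul_of_nonneg_right hf1 (by nlinarith)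
      nlinarith [sq_nonneg (16 * (r - 1) - (r + 1)), sq_nonneg (r - 1)]
    · have : f * (1 - r ^ 2) ≥ 0 := mul_nonneg hf0 (by nlinarith)
      nlinarith [sq_nonneg (r - 1), sq_nonneg r]
  linarith

/-- The expectation of a `[0, 1]`-valued function of the state at time `t` grows by at most
`8 D + 1 / 8` when the noise changes from `ν` to `ν'`, where `D`, the expectation under `ν` of
minus the log-likelihood ratio, bounds the relative entropy of the two laws of the state. -/
theorem integral_run_le_add_entropy (hpos : ∀ t h x, 0 < ℓ t h x)
    (hℓ : ∀ t h (φ : 𝓗 (t + 1) → ℝ),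
      ∫ x, φ (step t h x) ∂ν' = ∫ x, ℓ t h x * φ (step t h x) ∂ν)
    {t : ℕ} {f : 𝓗 t → ℝ} (hf0 : ∀ h, 0 ≤ f h) (hf1 : ∀ h, f h ≤ 1) :
    ∫ ξ, f (run h0 step ξ t) ∂(Measure.infinitePi fun _ : ℕ => ν') ≤
      ∫ ξ, f (run h0 step ξ t) ∂(Measure.infinitePi fun _ : ℕ => ν) +
        8 * (-∫ ξ, Real.log (likelihood h0 step ℓ ξ t) ∂(Measure.infinitePi fun _ : ℕ => ν)) +
          1 / 8 := by
  set P := Measure.infinitePi fun _ : ℕ => ν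
  have hi (g : 𝓗 t → ℝ → ℝ) :
      Integrable (fun ξ => g (run h0 step ξ t) (likelihood h0 step ℓ ξ t)) P :=
    integrable_of_dependsOn (dependsOn_run_likelihood t g) P
  have hone := integral_likelihood (h0 := h0) hℓ t
  have key : ∫ ξ, likelihood h0 step ℓ ξ t * f (run h0 step ξ t) ∂P ≤
      ∫ ξ, (f (run h0 step ξ t) + (8 + 1 / 16) * likelihood h0 step ℓ ξ t
        + (-8) * Real.log (likelihood h0 step ℓ ξ t) + (1 / 16 - 8)) ∂P := by
    refine integral_mono (hi fun h l => l * f h)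
      (hi fun h l => f h + (8 + 1 / 16) * l + (-8) * Real.log l + (1 / 16 - 8)) fun ξ => ?_
    have := mul_sub_one_le_log (hf0 (run h0 step ξ t)) (hf1 _) (likelihood_pos (h0 := h0)
      (step := step) hpos ξ t)
    simp only
    linarith
  rw [integral_run_eq_integral_likelihood_mul hℓ]
  refine key.trans (le_of_eq ?_)
  rw [integral_add (hi fun h l => f h + (8 + 1 / 16) * l + (-8) * Real.log l)
      (integrable_const _),
    integral_add (hi fun h l => f h + (8 + 1 / 16) * l) (hi fun _ l => (-8) * Real.log l),
    integral_add (hi fun h _ => f h) (hi fun _ l => (8 + 1 / 16) * l),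
    integral_const_mul, integral_const_mul, hone]
  simp only [integral_const, probReal_univ, smul_eq_mul, one_mul]
  ring

/-- The second-moment bound behind the bound for full information: `L f ≤ (α L² + f / α) / 2` for
an indicator `f`. -/
theorem integral_run_le_second_moment
    (hℓ : ∀ t h (φ : 𝓗 (t + 1) → ℝ),
      ∫ x, φ (step t h x) ∂ν' = ∫ x, ℓ t h x * φ (step t h x) ∂ν)
    {c : ℝ} (hc : ∀ t h, ∫ x, ℓ t h x ^ 2 ∂ν = c) {α : ℝ} (hα : 0 < α)
    {t : ℕ} {f : 𝓗 t → ℝ} (hf : ∀ h, f h ^ 2 = f h) :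
    ∫ ξ, f (run h0 step ξ t) ∂(Measure.infinitePi fun _ : ℕ => ν') ≤
      (α * c ^ t +
        (∫ ξ, f (run h0 step ξ t) ∂(Measure.infinitePi fun _ : ℕ => ν)) / α) / 2 := by
  set P := Measure.infinitePi fun _ : ℕ => ν with hP
  have hi (g : 𝓗 t → ℝ → ℝ) :
      Integrable (fun ξ => g (run h0 step ξ t) (likelihood h0 step ℓ ξ t)) P :=
    integrable_of_dependsOn (dependsOn_run_likelihood t g) P
  rw [integral_run_eq_integral_likelihood_mul hℓ, ← integral_likelihood_sq (h0 := h0) hc t, ← hP]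
  have : ∫ ξ, likelihood h0 step ℓ ξ t * f (run h0 step ξ t) ∂P ≤
      ∫ ξ, (α / 2 * likelihood h0 step ℓ ξ t ^ 2 + 1 / (2 * α) * f (run h0 step ξ t)) ∂P := by
    refine integral_mono (hi fun h l => l * f h)
      (hi fun h l => α / 2 * l ^ 2 + 1 / (2 * α) * f h) fun ξ => ?_
    have h1 := hf (run h0 step ξ t)
    simp only
    rw [← sub_nonneg]
    have : α / 2 * likelihood h0 step ℓ ξ t ^ 2 + 1 / (2 * α) * f (run h0 step ξ t) -
        likelihood h0 step ℓ ξ t * f (run h0 step ξ t) =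
        (α * likelihood h0 step ℓ ξ t - f (run h0 step ξ t)) ^ 2 / (2 * α) := by
      rw [sub_sq, h1]; field_simp; ring
    rw [this]; positivity
  refine this.trans (le_of_eq ?_)
  rw [integral_add (hi fun _ l => α / 2 * l ^ 2) (hi fun h _ => 1 / (2 * α) * f h),
    integral_const_mul, integral_const_mul]
  field_simp

end Adaptive

/-! ### The noise of the lazy bandit -/

section LazyNoise

/-- One noise value: whether the chosen arm takes effect at this step, and the cost level that each
of the `K` arms would set (`true` is cost `1`). -/
abbrev LazyNoise (K : ℕ) : Type := Bool × (Fin K → Bool)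

/-- The sign `1` of `true` and `-1` of `false`. -/
def boolSign (b : Bool) : ℝ := if b then 1 else -1

/-- The average of a function over all vectors of bits. -/
noncomputable def bitMean {K : ℕ} (f : (Fin K → Bool) → ℝ) : ℝ := (∑ x, f x) / 2 ^ K

/-- The density with respect to the unbiased noise that lowers the mean cost level of arm `j`
from `1 / 2` to `(1 - δ) / 2`. -/
def tilt {K : ℕ} (δ : ℝ) (j : Fin K) (x : LazyNoise K) : ℝ :=
  if x.1 then 1 - δ * boolSign (x.2 j) else 1

/-- The noise in which the arm takes effect with probability `p` and in which, given this, the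
vector of cost levels has density `τ` with respect to the uniform law. -/
noncomputable def lazyNoise {K : ℕ} (p : ℝ) (τ : LazyNoise K → ℝ) : Measure (LazyNoise K) :=
  ∑ x, ENNReal.ofReal ((if x.1 then p else 1 - p) / 2 ^ K * τ x) • Measure.dirac x

variable {K : ℕ} {p δ : ℝ}

theorem boolSign_mul_self (b : Bool) : boolSign b * boolSign b = 1 := by
  cases b <;> simp [boolSign]

theorem boolSign_not (b : Bool) : boolSign (!b) = -boolSign b := by
  cases b <;> simp [boolSign]

theorem bitMean_add (f g : (Fin K → Bool) → ℝ) :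
    bitMean (fun x => f x + g x) = bitMean f + bitMean g := by
  simp [bitMean, Finset.sum_add_distrib, add_div]

theorem bitMean_const_mul (c : ℝ) (f : (Fin K → Bool) → ℝ) :
    bitMean (fun x => c * f x) = c * bitMean f := by
  simp [bitMean, ← Finset.mul_sum, mul_div_assoc]

theorem bitMean_const (c : ℝ) : bitMean (fun _ : Fin K → Bool => c) = c := by
  simp [bitMean]

/-- The sign of coordinate `j` averages to zero against functions of the other coordinates. -/
theorem bitMean_boolSign_mul {j : Fin K} {f : (Fin K → Bool) → ℝ}
    (hf : ∀ x, f (Function.update x j (!x j)) = f x) :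
    bitMean (fun x => boolSign (x j) * f x) = 0 := by
  have hinv : Function.Involutive fun x : Fin K → Bool => Function.update x j (!x j) := by
    intro x; simp
  have : ∑ x : Fin K → Bool, boolSign (x j) * f x = -∑ x, boolSign (x j) * f x := by
    rw [← Finset.sum_neg_distrib, ← Equiv.sum_comp hinv.toPerm]
    refine Finset.sum_congr rfl fun x _ => ?_
    simp [Function.Involutive.coe_toPerm, boolSign_not, hf]
  rw [bitMean, self_eq_neg.1 this, zero_div]

theorem bitMean_boolSign (j : Fin K) : bitMean (fun x => boolSign (x j)) = 0 := by
  simpa using bitMean_boolSign_mul (j := j) (f := fun _ => 1) fun _ => rfl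

theorem tilt_pos (hδ0 : 0 ≤ δ) (hδ1 : δ < 1) (j : Fin K) (x : LazyNoise K) : 0 < tilt δ j x := by
  rcases x with ⟨b, x⟩
  cases b <;> simp only [tilt, Bool.false_eq_true, if_false, if_true, zero_lt_one]
  cases x j <;> simp only [boolSign, Bool.false_eq_true, if_false, if_true] <;> linarith

theorem tilt_zero (j : Fin K) : tilt 0 j = fun _ => 1 := by
  funext x; simp [tilt]

theorem integral_lazyNoise (hp0 : 0 ≤ p) (hp1 : p ≤ 1) {τ : LazyNoise K → ℝ} (hτ : ∀ x, 0 ≤ τ x)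
    (f : LazyNoise K → ℝ) :
    ∫ x, f x ∂(lazyNoise p τ) = p * bitMean (fun x => τ (true, x) * f (true, x)) +
      (1 - p) * bitMean (fun x => τ (false, x) * f (false, x)) := by
  rw [lazyNoise, integral_finsetSum_measure fun _ _ =>
    (integrable_dirac (by simp)).smul_measure ENNReal.ofReal_ne_top]
  have h (x : LazyNoise K) : 0 ≤ (if x.1 then p else 1 - p) / 2 ^ K * τ x := by
    refine mul_nonneg (div_nonneg ?_ (by positivity)) (hτ x)
    split_ifs <;> linarith
  simp only [integral_smul_measure, integral_dirac, ENNReal.toReal_ofReal (h _), smul_eq_mul]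
  rw [Fintype.sum_prod_type, Fintype.sum_bool]
  simp only [bitMean, Finset.sum_div, Finset.mul_sum, Bool.false_eq_true, if_false, if_true]
  congr 1 <;> exact Finset.sum_congr rfl fun x _ => by ring

theorem integral_lazyNoise_tilt (hp0 : 0 ≤ p) (hp1 : p ≤ 1) (hδ0 : 0 ≤ δ) (hδ1 : δ < 1)
    (j : Fin K) (f : LazyNoise K → ℝ) :
    ∫ x, f x ∂(lazyNoise p (tilt δ j)) = ∫ x, tilt δ j x * f x ∂(lazyNoise p fun _ => 1) := by
  rw [integral_lazyNoise hp0 hp1 fun x => (tilt_pos hδ0 hδ1 j x).le,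
    integral_lazyNoise hp0 hp1 fun _ => zero_le_one]
  simp only [one_mul]

theorem isProbabilityMeasure_lazyNoise (hp0 : 0 ≤ p) (hp1 : p ≤ 1) (hδ0 : 0 ≤ δ) (hδ1 : δ < 1)
    (j : Fin K) : IsProbabilityMeasure (lazyNoise p (tilt δ j)) := by
  have hfin : IsFiniteMeasure (lazyNoise p (tilt δ j)) := by
    refine ⟨?_⟩
    simp [lazyNoise, ENNReal.sum_lt_top]
  have h := integral_lazyNoise hp0 hp1 (fun x => (tilt_pos hδ0 hδ1 j x).le) fun _ => 1
  have h1 : bitMean (fun x => tilt δ j (true, x) * 1) = 1 := by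
    have : (fun x : Fin K → Bool => tilt δ j (true, x) * 1) =
        fun x => 1 + (-δ) * boolSign (x j) := by
      funext x; simp [tilt]; ring
    rw [this, bitMean_add, bitMean_const_mul, bitMean_boolSign, bitMean_const]; ring
  have h2 : bitMean (fun x => tilt δ j (false, x) * 1) = 1 := by
    simp [tilt, bitMean_const]
  rw [h1, h2, integral_const, smul_eq_mul] at h
  refine ⟨?_⟩
  have h3 : (lazyNoise p (tilt δ j)).real Set.univ = 1 := by linarith
  rwa [measureReal_def, ENNReal.toReal_eq_one_iff] at h3

theorem isProbabilityMeasure_lazyNoise_one [NeZero K] (hp0 : 0 ≤ p) (hp1 : p ≤ 1) :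
    IsProbabilityMeasure (lazyNoise (K := K) p fun _ => 1) := by
  rw [← tilt_zero (0 : Fin K)]
  exact isProbabilityMeasure_lazyNoise hp0 hp1 le_rfl zero_lt_one 0

/-- The mean cost level of arm `i` when arm `j` is the good one. -/
noncomputable def armMean (δ : ℝ) (j i : Fin K) : ℝ := (1 - if i = j then δ else 0) / 2

/-- The cost of a cost level. -/
def levelCost (b : Bool) : ℝ := if b then 1 else 0

theorem levelCost_eq (b : Bool) : levelCost b = 1 / 2 + 1 / 2 * boolSign b := by
  cases b <;> norm_num [levelCost, boolSign]

/-- One step of the cost level: arm `i` pulls it towards `armMean δ j i` at rate `p`. -/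
theorem integral_levelCost (hp0 : 0 ≤ p) (hp1 : p ≤ 1) (hδ0 : 0 ≤ δ) (hδ1 : δ < 1)
    (j i : Fin K) (s : Bool) :
    ∫ x, levelCost (if x.1 then x.2 i else s) ∂(lazyNoise p (tilt δ j)) =
      p * armMean δ j i + (1 - p) * levelCost s := by
  rw [integral_lazyNoise hp0 hp1 fun x => (tilt_pos hδ0 hδ1 j x).le]
  congr 2
  · by_cases hij : i = j
    · subst hij
      have : (fun x : Fin K → Bool => tilt δ i (true, x) *
          levelCost (if (true, x).1 then (true, x).2 i else s)) =
          fun x => (1 - δ) / 2 + (1 - δ) / 2 * boolSign (x i) := by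
        funext x
        simp only [tilt, if_true, levelCost_eq]
        linear_combination (-δ / 2) * boolSign_mul_self (x i)
      rw [this, bitMean_add, bitMean_const_mul, bitMean_boolSign, bitMean_const, armMean]
      simp
    · have : (fun x : Fin K → Bool => tilt δ j (true, x) *
          levelCost (if (true, x).1 then (true, x).2 i else s)) =
          fun x => 1 / 2 + (1 / 2 * boolSign (x i) + (-δ / 2) * (boolSign (x j) *
            (1 + boolSign (x i)))) := by
        funext x
        simp only [tilt, if_true, levelCost_eq]
        ring
      rw [this, bitMean_add, bitMean_add, bitMean_const_mul, bitMean_const_mul, bitMean_boolSign,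
        bitMean_const, bitMean_boolSign_mul, armMean]
      · simp [hij]
      · intro x; simp [hij]
  · simp [tilt, bitMean_const]

/-- A function that the cost level of arm `j` does not influence does not notice the tilt. -/
theorem integral_lazyNoise_tilt_of_invariant (hp0 : 0 ≤ p) (hp1 : p ≤ 1) (hδ0 : 0 ≤ δ)
    (hδ1 : δ < 1) {j : Fin K} {f : LazyNoise K → ℝ}
    (hf : ∀ x, f (true, Function.update x j (!x j)) = f (true, x)) :
    ∫ x, f x ∂(lazyNoise p (tilt δ j)) = ∫ x, f x ∂(lazyNoise p fun _ => 1) := by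
  rw [integral_lazyNoise hp0 hp1 fun x => (tilt_pos hδ0 hδ1 j x).le,
    integral_lazyNoise hp0 hp1 fun _ => zero_le_one]
  have : (fun x : Fin K → Bool => tilt δ j (true, x) * f (true, x)) =
      fun x => f (true, x) + (-δ) * (boolSign (x j) * f (true, x)) := by
    funext x; simp only [tilt, if_true]; ring
  rw [this, bitMean_add, bitMean_const_mul, bitMean_boolSign_mul hf]
  simp [tilt]

theorem integral_tilt_sq (hp0 : 0 ≤ p) (hp1 : p ≤ 1) (j : Fin K) :
    ∫ x, tilt δ j x ^ 2 ∂(lazyNoise p fun _ => 1) = 1 + p * δ ^ 2 := by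
  rw [integral_lazyNoise hp0 hp1 fun _ => zero_le_one]
  have : (fun x : Fin K → Bool => 1 * tilt δ j (true, x) ^ 2) =
      fun x => (1 + δ ^ 2) + (-2 * δ) * boolSign (x j) := by
    funext x; simp only [tilt, if_true]
    linear_combination δ ^ 2 * boolSign_mul_self (x j)
  rw [this, bitMean_add, bitMean_const_mul, bitMean_boolSign, bitMean_const]
  simp only [tilt, Bool.false_eq_true, if_false, bitMean_const]
  ring

/-- One effective observation of arm `j` carries relative entropy at most `δ ^ 2`. -/
theorem neg_integral_log_tilt_le (hp0 : 0 ≤ p) (hp1 : p ≤ 1) (hδ0 : 0 ≤ δ) (hδ1 : δ ≤ 1 / 2)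
    (j : Fin K) :
    -∫ x, Real.log (tilt δ j x) ∂(lazyNoise p fun _ => 1) ≤ p * δ ^ 2 := by
  rw [integral_lazyNoise hp0 hp1 fun _ => zero_le_one]
  have : (fun x : Fin K → Bool => 1 * Real.log (tilt δ j (true, x))) =
      fun x => (Real.log (1 - δ) + Real.log (1 + δ)) / 2 +
        (Real.log (1 - δ) - Real.log (1 + δ)) / 2 * boolSign (x j) := by
    funext x; simp only [tilt, if_true]
    cases x j
    · simp [boolSign]; ring
    · simp [boolSign]; ring
  rw [this, bitMean_add, bitMean_const_mul, bitMean_boolSign, bitMean_const]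
  simp only [tilt, Bool.false_eq_true, if_false, Real.log_one, mul_zero, bitMean_const]
  have hsq : 0 ≤ 1 / 4 - δ ^ 2 := by nlinarith
  have hpos : 0 < 1 - δ ^ 2 := by linarith
  have hlog : Real.log (1 - δ) + Real.log (1 + δ) = Real.log (1 - δ ^ 2) := by
    rw [← Real.log_mul (by linarith) (by linarith)]; congr 1; ring
  have hinv := Real.one_sub_inv_le_log_of_pos hpos
  have h2 : (1 - δ ^ 2)⁻¹ ≤ 1 + 2 * δ ^ 2 := by
    rw [inv_le_iff_one_le_mul₀ hpos]; nlinarith [mul_nonneg (sq_nonneg δ) hsq]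
  rw [hlog]
  have : -Real.log (1 - δ ^ 2) / 2 ≤ δ ^ 2 := by linarith
  nlinarith

theorem lazyNoise_singleton_pos (hp0 : 0 < p) (hδ0 : 0 ≤ δ) (hδ1 : δ < 1)
    (j : Fin K) (x : Fin K → Bool) : 0 < lazyNoise p (tilt δ j) {(true, x)} := by
  have : (lazyNoise p (tilt δ j)) {(true, x)} =
      ENNReal.ofReal (p / 2 ^ K * tilt δ j (true, x)) := by
    simp only [lazyNoise, Measure.coe_finsetSum, Finset.sum_apply, Measure.smul_apply,
      smul_eq_mul]
    rw [Finset.sum_eq_single (true, x)]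
    · simp
    · intro y _ hy; simp [hy]
    · simp
  rw [this, ENNReal.ofReal_pos]
  have := tilt_pos hδ0 hδ1 j (true, x)
  positivity

end LazyNoise

/-! ### The lazy bandit: gain, bias and return time -/

section LazyBandit

/-- The lazy bandit. The state consists of a cost level and an observation. An action `a` selects
the arm `arm a`; when the noise lets the action take effect, the cost level of this arm becomes the
new cost level, otherwise the old cost level stays. The cost is the new cost level, and `obs` is the
part of the noise that is revealed whatever the action is. The initial cost level is the highest
one, so that no algorithm can gain from the initial state. -/
def lazyBandit {n K : ℕ} {R : Type} [MeasurableSpace R] [Finite R] [MeasurableSingletonClass R]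
    (arm : Fin n → Fin K) (obs : LazyNoise K → R) :
    Dynamics (Bool × R) (Fin n) (LazyNoise K) where
  next s a x := (if x.1 then x.2 (arm a) else s.1, obs x)
  cost s a x := levelCost (if x.1 then x.2 (arm a) else s.1)
  init := (true, obs (true, fun _ => true))
  cost_mem s a x := by
    cases (if x.1 then x.2 (arm a) else s.1) <;> simp [levelCost]
  measurable_next := measurable_of_finite _
  measurable_cost := measurable_of_finite _

/-- The lazy bandit in which arm `j` has mean cost `(1 - δ) / 2` and all other arms `1 / 2`, and in
which an action takes effect with probability `p`. -/
noncomputable def lazyMDP {n K : ℕ} {R : Type} [MeasurableSpace R] [Finite R]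
    [MeasurableSingletonClass R] (arm : Fin n → Fin K) (obs : LazyNoise K → R) {p δ : ℝ}
    (hp0 : 0 ≤ p) (hp1 : p ≤ 1) (hδ0 : 0 ≤ δ) (hδ1 : δ < 1) (j : Fin K) :
    MDP (Bool × R) (Fin n) (LazyNoise K) where
  toDynamics := lazyBandit arm obs
  noise := lazyNoise p (tilt δ j)
  isProbabilityMeasure_noise := isProbabilityMeasure_lazyNoise hp0 hp1 hδ0 hδ1 j

theorem Dynamics.stateAt_eq_run {S A Ξ : Type} [MeasurableSpace S] [MeasurableSpace A]
    [MeasurableSpace Ξ] (E : Dynamics S A Ξ) (q : S → A) (s : S) (ξ : ℕ → Ξ) :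
    ∀ t, E.stateAt q s ξ t = run (𝓗 := fun _ => S) s (fun _ s x => E.next s (q s) x) ξ t
  | 0 => rfl
  | t + 1 => by rw [Dynamics.stateAt, run, E.stateAt_eq_run q s ξ t]

theorem Dynamics.stateAt_congr {S A Ξ : Type} [MeasurableSpace S] [MeasurableSpace A]
    [MeasurableSpace Ξ] (E : Dynamics S A Ξ) (q : S → A) (s : S) {ξ ξ' : ℕ → Ξ} {t : ℕ}
    (h : ∀ i < t, ξ i = ξ' i) : E.stateAt q s ξ t = E.stateAt q s ξ' t := by
  rw [E.stateAt_eq_run, E.stateAt_eq_run, run_congr h]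

theorem Dynamics.costAt_congr {S A Ξ : Type} [MeasurableSpace S] [MeasurableSpace A]
    [MeasurableSpace Ξ] (E : Dynamics S A Ξ) (q : S → A) (s : S) {ξ ξ' : ℕ → Ξ} {t : ℕ}
    (h : ∀ i < t + 1, ξ i = ξ' i) : E.costAt q s ξ t = E.costAt q s ξ' t := by
  rw [Dynamics.costAt, Dynamics.costAt,
    E.stateAt_congr q s fun i hi => h i (hi.trans t.lt_succ_self), h t t.lt_succ_self]

variable {n K : ℕ} {p δ : ℝ}

/-- The expected cost level moves from its old value towards the expected mean of the arm chosen,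
at rate `p`. -/
theorem integral_levelCost_run (hp0 : 0 ≤ p) (hp1 : p ≤ 1) (hδ0 : 0 ≤ δ) (hδ1 : δ < 1)
    {j : Fin K} {𝓗 : ℕ → Type} {h0 : 𝓗 0} {step : ∀ t, 𝓗 t → LazyNoise K → 𝓗 (t + 1)}
    {level : ∀ t, 𝓗 t → Bool} {choice : ∀ t, 𝓗 t → Fin K}
    (hlevel : ∀ t h x, level (t + 1) (step t h x) = if x.1 then x.2 (choice t h) else level t h)
    (t : ℕ) :
    ∫ ξ, levelCost (level (t + 1) (run h0 step ξ (t + 1)))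
        ∂(Measure.infinitePi fun _ : ℕ => lazyNoise p (tilt δ j)) =
      p * ∫ ξ, armMean δ j (choice t (run h0 step ξ t))
        ∂(Measure.infinitePi fun _ : ℕ => lazyNoise p (tilt δ j)) +
      (1 - p) * ∫ ξ, levelCost (level t (run h0 step ξ t))
        ∂(Measure.infinitePi fun _ : ℕ => lazyNoise p (tilt δ j)) := by
  have := isProbabilityMeasure_lazyNoise hp0 hp1 hδ0 hδ1 j
  simp only [run, hlevel]
  have hd : DependsOn (fun (ξ : ℕ → LazyNoise K) (x : LazyNoise K) =>
      levelCost (if x.1 then x.2 (choice t (run h0 step ξ t)) else level t (run h0 step ξ t)))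
      (Set.Iio t) :=
    dependsOn_run (β := LazyNoise K → ℝ) t fun h x => levelCost (if x.1 then x.2 (choice t h) else level t h)
  rw [integral_eval_of_dependsOn _ hd]
  simp only [integral_levelCost hp0 hp1 hδ0 hδ1]
  rw [integral_add, integral_const_mul, integral_const_mul]
  · exact (integrable_of_dependsOn (dependsOn_run t fun h => p * armMean δ j (choice t h)) _)
  · exact (integrable_of_dependsOn (dependsOn_run t fun h => (1 - p) * levelCost (level t h)) _)

variable {R : Type} [MeasurableSpace R] [Finite R] [MeasurableSingletonClass R]
  {arm : Fin n → Fin K} {obs : LazyNoise K → R}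

theorem integral_costAt_lazyMDP (hp0 : 0 ≤ p) (hp1 : p ≤ 1) (hδ0 : 0 ≤ δ) (hδ1 : δ < 1)
    (j : Fin K) (a : Fin n) (s : Bool × R) (t : ℕ) :
    ∫ ξ, (lazyMDP arm obs hp0 hp1 hδ0 hδ1 j).costAt (fun _ => a) s ξ t
        ∂(lazyMDP arm obs hp0 hp1 hδ0 hδ1 j).noiseSeq =
      armMean δ j (arm a) + (1 - p) ^ (t + 1) * (levelCost s.1 - armMean δ j (arm a)) := by
  have := isProbabilityMeasure_lazyNoise hp0 hp1 hδ0 hδ1 j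
  have key : ∀ t : ℕ, ∫ ξ, levelCost (run (𝓗 := fun _ => Bool × R) s
      (fun _ s x => (lazyBandit arm obs).next s a x) ξ t).1
        ∂(Measure.infinitePi fun _ : ℕ => lazyNoise p (tilt δ j)) =
      armMean δ j (arm a) + (1 - p) ^ t * (levelCost s.1 - armMean δ j (arm a)) := by
    intro t
    induction t with
    | zero => simp [run]
    | succ t ih =>
      have h := integral_levelCost_run hp0 hp1 hδ0 hδ1 (j := j) (𝓗 := fun _ => Bool × R) (h0 := s)
        (step := fun _ s x => (lazyBandit arm obs).next s a x) (level := fun _ s => s.1)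
        (choice := fun _ _ => arm a) (fun _ _ _ => rfl) t
      rw [h, ih]
      simp only [integral_const, probReal_univ, smul_eq_mul]
      ring
  rw [← key (t + 1)]
  refine integral_congr_ae (Eventually.of_forall fun ξ => ?_)
  simp only [Dynamics.costAt, Dynamics.stateAt_eq_run]
  rfl

theorem integrable_costAt_lazyMDP (hp0 : 0 ≤ p) (hp1 : p ≤ 1) (hδ0 : 0 ≤ δ) (hδ1 : δ < 1)
    (j : Fin K) (a : Fin n) (s : Bool × R) (t : ℕ) :
    Integrable (fun ξ => (lazyMDP arm obs hp0 hp1 hδ0 hδ1 j).costAt (fun _ => a) s ξ t)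
      (lazyMDP arm obs hp0 hp1 hδ0 hδ1 j).noiseSeq := by
  have := isProbabilityMeasure_lazyNoise hp0 hp1 hδ0 hδ1 j
  have : IsProbabilityMeasure (lazyMDP arm obs hp0 hp1 hδ0 hδ1 j).noiseSeq := by
    unfold MDP.noiseSeq; infer_instance
  exact integrable_of_dependsOn (t := t + 1)
    (fun ξ ξ' h => Dynamics.costAt_congr _ _ _ fun i hi => h i hi) _

theorem tendsto_meanCost_lazyMDP (hp0 : 0 < p) (hp1 : p ≤ 1) (hδ0 : 0 ≤ δ) (hδ1 : δ < 1)
    (j : Fin K) (a : Fin n) (s : Bool × R) :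
    Tendsto ((lazyMDP arm obs hp0.le hp1 hδ0 hδ1 j).meanCost (fun _ => a) s) atTop
      (𝓝 (armMean δ j (arm a))) := by
  have h1 : Tendsto (fun t : ℕ => armMean δ j (arm a) +
      (1 - p) ^ (t + 1) * (levelCost s.1 - armMean δ j (arm a))) atTop
      (𝓝 (armMean δ j (arm a))) := by
    have := (tendsto_pow_atTop_nhds_zero_of_lt_one (r := 1 - p) (by linarith)
      (by linarith)).comp (tendsto_add_atTop_nat 1)
    simpa using (this.mul_const (levelCost s.1 - armMean δ j (arm a))).const_add
      (armMean δ j (arm a))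
  refine h1.cesaro.congr fun T => ?_
  rw [MDP.meanCost, integral_finsetSum _ fun t _ => integrable_costAt_lazyMDP _ _ _ _ _ _ _ _]
  simp only [integral_costAt_lazyMDP]
  rw [div_eq_inv_mul]

theorem avgCost_lazyMDP (hp0 : 0 < p) (hp1 : p ≤ 1) (hδ0 : 0 ≤ δ) (hδ1 : δ < 1)
    (j : Fin K) (a : Fin n) (s : Bool × R) :
    (lazyMDP arm obs hp0.le hp1 hδ0 hδ1 j).avgCost (fun _ => a) s = armMean δ j (arm a) :=
  (tendsto_meanCost_lazyMDP hp0 hp1 hδ0 hδ1 j a s).limUnder_eq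

theorem tendsto_relativeCost_lazyMDP (hp0 : 0 < p) (hp1 : p ≤ 1) (hδ0 : 0 ≤ δ) (hδ1 : δ < 1)
    (j : Fin K) (a : Fin n) (s : Bool × R) :
    Tendsto ((lazyMDP arm obs hp0.le hp1 hδ0 hδ1 j).relativeCost (fun _ => a) s) atTop
      (𝓝 ((1 / p - 1) * (levelCost s.1 - armMean δ j (arm a)))) := by
  have h1 : HasSum (fun t : ℕ => (1 - p) ^ t * ((1 - p) *
      (levelCost s.1 - armMean δ j (arm a))))
      ((1 / p - 1) * (levelCost s.1 - armMean δ j (arm a))) := by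
    have hsum : (1 / p - 1) * (levelCost s.1 - armMean δ j (arm a)) =
        (1 - (1 - p))⁻¹ * ((1 - p) * (levelCost s.1 - armMean δ j (arm a))) := by
      rw [sub_sub_cancel]; field_simp
    rw [hsum]
    exact (hasSum_geometric_of_lt_one (by linarith) (by linarith)).mul_right _
  refine h1.tendsto_sum_nat.congr fun T => ?_
  have := isProbabilityMeasure_lazyNoise hp0.le hp1 hδ0 hδ1 j
  have : IsProbabilityMeasure (lazyMDP arm obs hp0.le hp1 hδ0 hδ1 j).noiseSeq := by
    unfold MDP.noiseSeq; infer_instance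
  simp only [MDP.relativeCost, avgCost_lazyMDP hp0]
  have hi (t : ℕ) : Integrable (fun ξ => (lazyMDP arm obs hp0.le hp1 hδ0 hδ1 j).costAt
      (fun _ => a) s ξ t - armMean δ j (arm a))
      (lazyMDP arm obs hp0.le hp1 hδ0 hδ1 j).noiseSeq :=
    (integrable_costAt_lazyMDP _ _ _ _ _ _ _ _).sub (integrable_const _)
  rw [integral_finsetSum _ fun t _ => hi t]
  refine Finset.sum_congr rfl fun t _ => ?_
  rw [integral_sub (integrable_costAt_lazyMDP _ _ _ _ _ _ _ _) (integrable_const _),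
    integral_costAt_lazyMDP]
  simp only [integral_const, probReal_univ, smul_eq_mul]
  ring

theorem armMean_mem (hδ0 : 0 ≤ δ) (hδ1 : δ < 1) (j i : Fin K) :
    armMean δ j i ∈ Set.Icc (0 : ℝ) 1 := by
  unfold armMean
  constructor <;> split_ifs <;> linarith

/-- The bias of a constant policy in the lazy bandit has span `1 / p - 1`. -/
theorem gainBiasAssumption_lazyMDP (hp0 : 0 < p) (hp1 : p ≤ 1) (hδ0 : 0 ≤ δ) (hδ1 : δ < 1)
    (j : Fin K) {Θ : Type} [PseudoMetricSpace Θ] (e : Θ ≃ Fin n)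
    (hdist : ∀ θ θ' : Θ, θ ≠ θ' → 1 ≤ dist θ θ') {H : ℝ} (hH : 1 / p - 1 ≤ H) :
    (lazyMDP arm obs hp0.le hp1 hδ0 hδ1 j).GainBiasAssumption (fun θ _ => e θ) H where
  tendsto_avgCost θ s := by
    rw [avgCost_lazyMDP hp0]; exact tendsto_meanCost_lazyMDP hp0 hp1 hδ0 hδ1 j _ s
  avgCost_uniform θ s := by rw [avgCost_lazyMDP hp0, avgCost_lazyMDP hp0]
  tendsto_bias θ s := by
    have := tendsto_relativeCost_lazyMDP (arm := arm) (obs := obs) hp0 hp1 hδ0 hδ1 j (e θ) s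
    rw [MDP.bias, this.limUnder_eq]
    exact this
  bias_span θ s s' := by
    have hb (s) : (lazyMDP arm obs hp0.le hp1 hδ0 hδ1 j).bias (fun _ => e θ) s = _ :=
      (tendsto_relativeCost_lazyMDP (arm := arm) (obs := obs) hp0 hp1 hδ0 hδ1 j (e θ) s).limUnder_eq
    rw [hb s, hb s', ← mul_sub]
    have h1 : 0 ≤ 1 / p - 1 := by
      rw [sub_nonneg, le_div_iff₀ hp0]; linarith
    rw [abs_mul, abs_of_nonneg h1, sub_sub_sub_cancel_right]
    have h2 : |levelCost s.1 - levelCost s'.1| ≤ 1 := by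
      cases s.1 <;> cases s'.1 <;> simp [levelCost]
    nlinarith
  lipschitz := by
    refine ⟨1, LipschitzWith.of_dist_le_mul fun θ θ' => ?_⟩
    rcases eq_or_ne θ θ' with rfl | hne
    · simp
    · simp only [avgCost_lazyMDP hp0]
      have h1 := armMean_mem hδ0 hδ1 j (arm (e θ))
      have h2 := armMean_mem hδ0 hδ1 j (arm (e θ'))
      have h3 := hdist θ θ' hne
      rw [Real.dist_eq, NNReal.coe_one, one_mul]
      exact (abs_sub_le_iff.2 ⟨by linarith [h1.2, h2.1], by linarith [h1.1, h2.2]⟩).trans h3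

/-- If a noise value of positive probability `ν {x}` leads to the initial state from every state,
then the expected return time is at most the mean `(1 - ν {x}ᶜ)⁻¹` of a geometric variable. -/
theorem MDP.expectedReturn_le {S A Ξ : Type} [MeasurableSpace S] [MeasurableSpace A]
    [MeasurableSpace Ξ] [MeasurableSingletonClass Ξ] (M : MDP S A Ξ) (q : S → A) (x : Ξ)
    (hx : ∀ s, M.next s (q s) x = M.init) (s : S) :
    M.expectedReturn q s ≤ (1 - M.noise {x}ᶜ)⁻¹ := by
  have hmeas (t : ℕ) : MeasurableSet (Set.pi (Finset.range t) fun _ : ℕ => ({x}ᶜ : Set Ξ)) :=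
    MeasurableSet.pi (Finset.range t).countable_toSet fun _ _ => (measurableSet_singleton x).compl
  have hpt (ξ : ℕ → Ξ) : (⨅ (t : ℕ) (_ : M.stateAt q s ξ t = M.init), (t : ℝ≥0∞)) ≤
      ∑' t : ℕ, (Set.pi (Finset.range t) fun _ : ℕ => ({x}ᶜ : Set Ξ)).indicator 1 ξ := by
    classical
    by_cases h : ∃ i, ξ i = x
    · refine (iInf₂_le (Nat.find h + 1) ?_).trans ?_
      · rw [Dynamics.stateAt, Nat.find_spec h, hx]
      · refine le_trans ?_ (ENNReal.sum_le_tsum (Finset.range (Nat.find h + 1)))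
        rw [Finset.sum_congr rfl fun t ht => Set.indicator_of_mem (f := (1 : (ℕ → Ξ) → ℝ≥0∞)) ?_]
        · simp
        · intro i hi
          simp only [Finset.coe_range, Set.mem_Iio] at hi
          exact Nat.find_min h (lt_of_lt_of_le hi (Nat.lt_succ_iff.1 (Finset.mem_range.1 ht)))
    · push Not at h
      have : ∀ t : ℕ, (Set.pi (Finset.range t) fun _ : ℕ => ({x}ᶜ : Set Ξ)).indicator
          (1 : (ℕ → Ξ) → ℝ≥0∞) ξ = 1 := fun t => Set.indicator_of_mem (Set.mem_pi.2 fun i _ => h i) _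
      simp only [this, ENNReal.tsum_const_eq_top_of_ne_zero one_ne_zero, le_top]
  calc M.expectedReturn q s
      ≤ ∫⁻ ξ, ∑' t : ℕ, (Set.pi (Finset.range t) fun _ : ℕ => ({x}ᶜ : Set Ξ)).indicator 1 ξ
          ∂M.noiseSeq := lintegral_mono hpt
    _ = ∑' t : ℕ, M.noise {x}ᶜ ^ t := by
        rw [lintegral_tsum fun t => (measurable_one.indicator (hmeas t)).aemeasurable]
        refine tsum_congr fun t => ?_
        rw [lintegral_indicator_one (hmeas t), MDP.noiseSeq, Measure.infinitePi_pi]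
        · simp
        · exact fun _ _ => (measurableSet_singleton x).compl
    _ = _ := ENNReal.tsum_geometric _

theorem restartAssumption_lazyMDP (hp0 : 0 < p) (hp1 : p ≤ 1) (hδ0 : 0 ≤ δ) (hδ1 : δ < 1)
    (j : Fin K) {Θ : Type} [Nonempty Θ] (π : Θ → Bool × R → Fin n) :
    (lazyMDP arm obs hp0.le hp1 hδ0 hδ1 j).RestartAssumption π := by
  have := isProbabilityMeasure_lazyNoise hp0.le hp1 hδ0 hδ1 j
  set x : LazyNoise K := (true, fun _ => true)
  have hx : lazyNoise p (tilt δ j) {x}ᶜ < 1 := by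
    rw [lt_iff_le_and_ne, Ne, prob_compl_eq_one_iff (measurableSet_singleton x)]
    exact ⟨prob_le_one, (lazyNoise_singleton_pos hp0 hδ0 hδ1 j _).ne'⟩
  have htop : (1 - lazyNoise p (tilt δ j) {x}ᶜ)⁻¹ ≠ ∞ :=
    ENNReal.inv_ne_top.2 (tsub_pos_of_lt hx).ne'
  obtain ⟨D, hD⟩ := ENNReal.exists_nat_gt htop
  refine ⟨Classical.arbitrary Θ, D + 1, D.succ_pos, fun s => ?_⟩
  refine (MDP.expectedReturn_le _ _ x (fun s => rfl) s).trans (hD.le.trans ?_)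
  exact_mod_cast D.le_succ

end LazyBandit

/-! ### The sample-path policy order -/

section Order

variable {S A Ξ Θ : Type} [MeasurableSpace S] [MeasurableSpace A] [MeasurableSpace Ξ]

theorem Dynamics.samplePath_congr (E : Dynamics S A Ξ) (q : S → A) {T : ℕ} {ξ ξ' : ℕ → Ξ}
    (h : ∀ i < T, ξ i = ξ' i) : E.samplePath q T ξ = E.samplePath q T ξ' := by
  funext t
  have ht : ∀ i < (t : ℕ) + 1, ξ i = ξ' i := fun i hi => h i (by omega)
  simp only [Dynamics.samplePath, E.stateAt_congr q E.init ht, E.costAt_congr q E.init ht,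
    E.stateAt_congr q E.init fun i (hi : i < (t : ℕ)) => h i (by omega)]

theorem measurable_empiricalCost (T : ℕ) :
    Measurable (empiricalCost : (Fin T → Transition S A) → ℝ) := by
  unfold empiricalCost Transition.cost
  fun_prop

theorem Dynamics.samplePathLE_of_eq_comp (E : Dynamics S A Ξ) {π : Θ → S → A} {θ' θ : Θ}
    (h : ∀ T, ∃ Φ : (Fin T → Transition S A) → ℝ, Measurable Φ ∧
      ∀ ξ, empiricalCost (E.samplePath (π θ') T ξ) = Φ (E.samplePath (π θ) T ξ)) :
    E.SamplePathLE π θ' θ := by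
  intro T _
  obtain ⟨Φ, hΦ, h⟩ := h T
  simp only [h]
  exact hΦ.comp (comap_measurable (E.samplePath (π θ) T))

/-- The average cost of a smaller policy is a function of the sample path of the larger one. -/
theorem Dynamics.SamplePathLE.empiricalCost_eq {E : Dynamics S A Ξ} {π : Θ → S → A} {θ' θ : Θ}
    (h : E.SamplePathLE π θ' θ) {T : ℕ} (hT : 1 ≤ T) {ξ ξ' : ℕ → Ξ}
    (hξ : E.samplePath (π θ) T ξ = E.samplePath (π θ) T ξ') :
    empiricalCost (E.samplePath (π θ') T ξ) = empiricalCost (E.samplePath (π θ') T ξ') := by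
  obtain ⟨B, -, hB⟩ := h T hT
    (measurableSet_singleton (empiricalCost (E.samplePath (π θ') T ξ)))
  have h1 : ξ ∈ E.samplePath (π θ) T ⁻¹' B := by rw [hB]; rfl
  have h2 : ξ' ∈ E.samplePath (π θ) T ⁻¹' B := by
    rwa [Set.mem_preimage, ← hξ]
  rw [hB] at h2
  exact h2.symm

/-- If the noise can be read off the next state, then every policy reveals the cost of every
other. -/
theorem Dynamics.samplePathLE_of_revealing [Finite Ξ] [MeasurableSingletonClass Ξ] [Nonempty Ξ]
    (E : Dynamics S A Ξ) {read : S → Ξ} (hread : Measurable read)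
    (h : ∀ s a x, read (E.next s a x) = x) (π : Θ → S → A) (θ' θ : Θ) :
    E.SamplePathLE π θ' θ := by
  refine E.samplePathLE_of_eq_comp fun T => ?_
  let extend : (Fin T → Ξ) → ℕ → Ξ := fun r i =>
    if hi : i < T then r ⟨i, hi⟩ else Classical.arbitrary Ξ
  have h1 : Measurable fun (z : Fin T → Transition S A) (i : Fin T) => read (z i).2.2.2 :=
    measurable_pi_iff.2 fun i => hread.comp (measurable_pi_apply i).snd.snd.snd
  have h2 : Measurable fun r : Fin T → Ξ => empiricalCost (E.samplePath (π θ') T (extend r)) :=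
    measurable_of_finite _
  refine ⟨_, h2.comp h1, fun ξ => ?_⟩
  rw [Function.comp_apply]
  congr 1
  refine E.samplePath_congr _ fun i hi => ?_
  simp [extend, hi, Dynamics.samplePath, Dynamics.stateAt, h]

theorem isPreorder_of_iff_eq {α β : Type} {r : α → α → Prop} (f : α → β)
    (h : ∀ a b, r a b ↔ f a = f b) : IsPreorder α r where
  refl a := (h a a).2 rfl
  trans a b c hab hbc := (h a c).2 (((h a b).1 hab).trans ((h b c).1 hbc))

/-- The width of the pullback of equality is the number of classes. -/
theorem hasWidth_of_iff_eq {α β : Type} [Fintype β] {r : α → α → Prop} {f : α → β}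
    (hf : Function.Surjective f) (h : ∀ a b, r a b ↔ f a = f b) :
    HasWidth r (Fintype.card β) := by
  classical
  constructor
  · refine ⟨Finset.univ.map ⟨Function.surjInv hf, Function.injective_surjInv hf⟩, by simp, ?_⟩
    intro a ha b hb hab hr
    obtain ⟨i, rfl⟩ : ∃ i, Function.surjInv hf i = a := by simpa using ha
    obtain ⟨j, rfl⟩ : ∃ i, Function.surjInv hf i = b := by simpa using hb
    refine hab ?_
    have := (h _ _).1 hr
    rw [Function.surjInv_eq hf, Function.surjInv_eq hf] at this
    rw [this]
  · rintro k ⟨s, rfl, hs⟩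
    refine Finset.card_le_card_of_injOn f (fun _ _ => Finset.mem_univ _) fun a ha b hb hab => ?_
    by_contra hne
    exact hs ha hb hne ((h a b).2 hab)

variable {n K : ℕ} {R : Type} [MeasurableSpace R] [Finite R] [MeasurableSingletonClass R]

theorem lazyBandit_stateAt_eq {arm : Fin n → Fin K} {obs : LazyNoise K → R} {a a' : Fin n}
    (h : arm a = arm a') (s : Bool × R) (ξ : ℕ → LazyNoise K) :
    ∀ t, (lazyBandit arm obs).stateAt (fun _ => a) s ξ t =
      (lazyBandit arm obs).stateAt (fun _ => a') s ξ t
  | 0 => rfl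
  | t + 1 => by
    rw [Dynamics.stateAt, Dynamics.stateAt, lazyBandit_stateAt_eq h s ξ t]
    simp [lazyBandit, h]

/-- Without side observations, two policies are related exactly if they use the same arm. -/
theorem lazyBandit_samplePathLE_iff {arm : Fin n → Fin K} (e : Θ → Fin n) (θ' θ : Θ) :
    (lazyBandit arm fun _ => ()).SamplePathLE (fun θ _ => e θ) θ' θ ↔
      arm (e θ') = arm (e θ) := by
  constructor
  · intro h
    by_contra hne
    have := h.empiricalCost_eq le_rfl (ξ := fun _ => (true, fun _ => true))
      (ξ' := fun _ => (true, Function.update (fun _ => true) (arm (e θ')) false)) ?_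
    · simp [empiricalCost, Dynamics.samplePath, Transition.cost, Dynamics.costAt, lazyBandit,
        levelCost] at this
    · funext t
      obtain rfl : t = 0 := Subsingleton.elim _ _
      simp [Dynamics.samplePath, Dynamics.costAt, Dynamics.stateAt, lazyBandit, Ne.symm hne]
  · intro h
    refine Dynamics.samplePathLE_of_eq_comp _ fun T => ⟨empiricalCost, measurable_empiricalCost T, ?_⟩
    intro ξ
    unfold empiricalCost
    congr 1
    refine Finset.sum_congr rfl fun t _ => ?_
    simp only [Transition.cost, Dynamics.samplePath, Dynamics.costAt,
      lazyBandit_stateAt_eq h]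
    simp [lazyBandit, h]

end Order

/-! ### The interaction of an algorithm with the lazy bandit -/

section Interaction

variable {S A Ξ Θ : Type} [MeasurableSpace S] [MeasurableSpace A] [MeasurableSpace Ξ]
  [MeasurableSpace Θ]

/-- One step of the interaction of an algorithm, as a map on pairs of a sample path and a current
state. -/
def Dynamics.interactStep (E : Dynamics S A Ξ) (π : Θ → S → A) (alg : Algorithm S A Θ)
    (u : alg.Seed) (t : ℕ) (h : (Fin t → Transition S A) × S) (x : Ξ) :
    (Fin (t + 1) → Transition S A) × S :=
  let a := π (alg.choose t u h.1 h.2) h.2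
  (Fin.snoc (α := fun _ => Transition S A) h.1 (h.2, a, E.cost h.2 a x, E.next h.2 a x),
    E.next h.2 a x)

theorem Dynamics.interact_eq_run (E : Dynamics S A Ξ) (π : Θ → S → A) (alg : Algorithm S A Θ)
    (u : alg.Seed) (ξ : ℕ → Ξ) :
    ∀ t, E.interact π alg u ξ t = run (𝓗 := fun t => (Fin t → Transition S A) × S)
      (Fin.elim0, E.init) (E.interactStep π alg u) ξ t
  | 0 => rfl
  | t + 1 => by rw [Dynamics.interact, run, E.interact_eq_run π alg u ξ t]; rfl

theorem Dynamics.measurable_interact (E : Dynamics S A Ξ) {π : Θ → S → A}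
    (hπ : Measurable fun z : Θ × S => π z.1 z.2) (alg : Algorithm S A Θ) :
    ∀ t, Measurable fun z : alg.Seed × (ℕ → Ξ) => E.interact π alg z.1 z.2 t
  | 0 => measurable_const
  | t + 1 => by
    have ih := E.measurable_interact hπ alg t
    have hs : Measurable fun z : alg.Seed × (ℕ → Ξ) => (E.interact π alg z.1 z.2 t).2 := ih.snd
    have ha : Measurable fun z : alg.Seed × (ℕ → Ξ) =>
        π (alg.choose t z.1 (E.interact π alg z.1 z.2 t).1 (E.interact π alg z.1 z.2 t).2)
          (E.interact π alg z.1 z.2 t).2 :=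
      hπ.comp (((alg.measurable_choose t).comp (measurable_fst.prodMk ih)).prodMk hs)
    have hx : Measurable fun z : alg.Seed × (ℕ → Ξ) => z.2 t :=
      (measurable_pi_apply t).comp measurable_snd
    have hn := E.measurable_next.comp (hs.prodMk (ha.prodMk hx))
    have hc := E.measurable_cost.comp (hs.prodMk (ha.prodMk hx))
    refine Measurable.prodMk (measurable_pi_iff.2 fun i => ?_) hn
    refine Fin.lastCases ?_ (fun i => ?_) i
    · simp only [Fin.snoc_last]
      exact hs.prodMk (ha.prodMk (hc.prodMk hn))
    · simp only [Fin.snoc_castSucc]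
      exact (measurable_pi_apply i).comp ih.fst

theorem Dynamics.sum_cost_interact_succ (E : Dynamics S A Ξ) (π : Θ → S → A)
    (alg : Algorithm S A Θ) (u : alg.Seed) (ξ : ℕ → Ξ) (T : ℕ) :
    ∑ t, ((E.interact π alg u ξ (T + 1)).1 t).cost =
      ∑ t, ((E.interact π alg u ξ T).1 t).cost +
        E.cost (E.interact π alg u ξ T).2
          (π (alg.choose T u (E.interact π alg u ξ T).1 (E.interact π alg u ξ T).2)
            (E.interact π alg u ξ T).2) (ξ T) := by
  rw [Fin.sum_univ_castSucc]
  simp only [Dynamics.interact, Fin.snoc_castSucc, Fin.snoc_last]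
  rfl

theorem Dynamics.sum_cost_interact_mem (E : Dynamics S A Ξ) (π : Θ → S → A)
    (alg : Algorithm S A Θ) (u : alg.Seed) (ξ : ℕ → Ξ) (T : ℕ) :
    ∑ t, ((E.interact π alg u ξ T).1 t).cost ∈ Set.Icc (0 : ℝ) T := by
  induction T with
  | zero => simp
  | succ T ih =>
    rw [E.sum_cost_interact_succ]
    have := E.cost_mem (E.interact π alg u ξ T).2
      (π (alg.choose T u (E.interact π alg u ξ T).1 (E.interact π alg u ξ T).2)
        (E.interact π alg u ξ T).2) (ξ T)
    push_cast
    exact ⟨by linarith [ih.1, this.1], by linarith [ih.2, this.2]⟩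

theorem MDP.integrable_regret (M : MDP S A Ξ) {π : Θ → S → A}
    (hπ : Measurable fun z : Θ × S => π z.1 z.2) (alg : Algorithm S A Θ) (T : ℕ) :
    Integrable (fun z => M.regret π alg T z.1 z.2) (alg.law.prod M.noiseSeq) := by
  have : IsProbabilityMeasure M.noiseSeq := by unfold MDP.noiseSeq; infer_instance
  refine Integrable.sub ?_ (integrable_const _)
  refine Integrable.of_bound (C := T) ?_ (Eventually.of_forall fun z => ?_)
  · refine (Finset.measurable_sum _ fun t _ => ?_).aestronglyMeasurable
    have h := (measurable_pi_apply t).comp (M.measurable_interact hπ alg T).fst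
    exact h.snd.snd.fst
  · have := M.sum_cost_interact_mem π alg z.1 z.2 T
    rw [Real.norm_of_nonneg this.1]
    exact this.2

variable {n K : ℕ} {R : Type} [MeasurableSpace R] [Finite R] [MeasurableSingletonClass R]
  {arm : Fin n → Fin K} {obs : LazyNoise K → R} {p δ : ℝ}

theorem lazyBandit_sum_cost (π : Θ → Bool × R → Fin n) (alg : Algorithm (Bool × R) (Fin n) Θ)
    (u : alg.Seed) (ξ : ℕ → LazyNoise K) (T : ℕ) :
    ∑ t, (((lazyBandit arm obs).interact π alg u ξ T).1 t).cost =
      ∑ t ∈ Finset.range T, levelCost ((lazyBandit arm obs).interact π alg u ξ (t + 1)).2.1 := by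
  induction T with
  | zero => simp
  | succ T ih =>
    rw [Dynamics.sum_cost_interact_succ, Finset.sum_range_succ, ih]
    rfl

/-- The probability, given the seed, that the algorithm plays arm `j` at time `t` when the noise is
`ν`. -/
noncomputable def playProb (arm : Fin n → Fin K) (obs : LazyNoise K → R) (e : Θ → Fin n)
    (alg : Algorithm (Bool × R) (Fin n) Θ) (u : alg.Seed) (ν : Measure (LazyNoise K)) (j : Fin K)
    (t : ℕ) : ℝ :=
  ∫ ξ, (fun h : (Fin t → Transition (Bool × R) (Fin n)) × (Bool × R) =>
    if arm (e (alg.choose t u h.1 h.2)) = j then (1 : ℝ) else 0)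
      (run (𝓗 := fun t => (Fin t → Transition (Bool × R) (Fin n)) × (Bool × R))
        (Fin.elim0, (lazyBandit arm obs).init)
        ((lazyBandit arm obs).interactStep (fun θ _ => e θ) alg u) ξ t)
    ∂(Measure.infinitePi fun _ : ℕ => ν)

/-- Telescoping the pull of the cost level towards the means of the arms gives the regret as the
regret of the arms played plus a multiple of the drop of the expected cost level, which starts at
its largest value. -/
theorem sum_playProb_le_integral_regret (hp0 : 0 < p) (hp1 : p ≤ 1) (hδ0 : 0 ≤ δ) (hδ1 : δ < 1)
    (j : Fin K) (e : Θ ≃ Fin n) (harm : Function.Surjective arm)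
    (alg : Algorithm (Bool × R) (Fin n) Θ) (u : alg.Seed) (T : ℕ) :
    δ / 2 * ∑ t ∈ Finset.range T, (1 - playProb arm obs e alg u (lazyNoise p (tilt δ j)) j t) ≤
      ∫ ξ, (lazyMDP arm obs hp0.le hp1 hδ0 hδ1 j).regret (fun θ _ => e θ) alg T u ξ
        ∂(lazyMDP arm obs hp0.le hp1 hδ0 hδ1 j).noiseSeq := by
  set M := lazyMDP arm obs hp0.le hp1 hδ0 hδ1 j with hM
  have := isProbabilityMeasure_lazyNoise hp0.le hp1 hδ0 hδ1 j
  have hprob : IsProbabilityMeasure M.noiseSeq := by unfold MDP.noiseSeq; infer_instance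
  let 𝓗 : ℕ → Type := fun t => (Fin t → Transition (Bool × R) (Fin n)) × (Bool × R)
  set h0 : 𝓗 0 := (Fin.elim0, (lazyBandit arm obs).init)
  set step : ∀ t, 𝓗 t → LazyNoise K → 𝓗 (t + 1) :=
    (lazyBandit arm obs).interactStep (fun θ _ => e θ) alg u
  let choice : ∀ t, 𝓗 t → Fin K := fun t h => arm (e (alg.choose t u h.1 h.2))
  let ℓ : ℕ → ℝ := fun t => ∫ ξ, levelCost (run h0 step ξ t).2.1 ∂M.noiseSeq
  have hint (t : ℕ) (f : 𝓗 t → ℝ) : Integrable (fun ξ => f (run h0 step ξ t)) M.noiseSeq :=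
    integrable_of_dependsOn (dependsOn_run t f) _
  have hrec (t : ℕ) : ℓ (t + 1) = p * ((1 - δ) / 2 + δ / 2 *
      (1 - playProb arm obs e alg u (lazyNoise p (tilt δ j)) j t)) + (1 - p) * ℓ t := by
    refine (integral_levelCost_run hp0.le hp1 hδ0 hδ1 (j := j) (h0 := h0) (step := step)
      (level := fun t (h : 𝓗 t) => h.2.1) (choice := choice) (fun _ _ _ => rfl) t).trans ?_
    congr 2
    have harmMean (i : Fin K) : armMean δ j i = 1 / 2 - δ / 2 * (if i = j then 1 else 0) := by
      unfold armMean; split_ifs <;> ring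
    simp only [harmMean]
    refine (integral_sub (integrable_const _)
      (hint t fun h => δ / 2 * (if choice t h = j then 1 else 0))).trans ?_
    rw [integral_const_mul]
    simp only [integral_const, probReal_univ, smul_eq_mul, one_mul]
    change 1 / 2 - δ / 2 * playProb arm obs e alg u (lazyNoise p (tilt δ j)) j t = _
    ring
  have htel : ∀ T : ℕ, p * ∑ t ∈ Finset.range T, (ℓ (t + 1) - (1 - δ) / 2) =
      p * (δ / 2 * ∑ t ∈ Finset.range T,
        (1 - playProb arm obs e alg u (lazyNoise p (tilt δ j)) j t)) +
        (1 - p) * (ℓ 0 - ℓ T) := by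
    intro T
    induction T with
    | zero => simp
    | succ T ih =>
      rw [Finset.sum_range_succ, Finset.sum_range_succ, mul_add, ih]
      linear_combination hrec T
  have hℓ0 : ℓ 0 = 1 := by
    simp [ℓ, run, h0, lazyBandit, levelCost]
  have hℓT : ℓ T ≤ 1 := by
    have : ℓ T ≤ ∫ _, (1 : ℝ) ∂M.noiseSeq := by
      refine integral_mono (hint T fun h => levelCost h.2.1) (integrable_const _) fun ξ => ?_
      simp only [levelCost]
      split_ifs <;> norm_num
    simpa using this
  have hmin : ⨅ θ : Θ, M.avgCost (fun _ => e θ) M.init ≤ (1 - δ) / 2 := by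
    have : Finite Θ := Finite.of_equiv _ e.symm
    obtain ⟨a, ha⟩ := harm j
    refine (ciInf_le (Set.finite_range _).bddBelow (e.symm a)).trans (le_of_eq ?_)
    rw [hM, avgCost_lazyMDP hp0]
    simp [ha, armMean]
  have hreg : ∫ ξ, M.regret (fun θ _ => e θ) alg T u ξ ∂M.noiseSeq =
      ∑ t ∈ Finset.range T, ℓ (t + 1) - T * ⨅ θ : Θ, M.avgCost (fun _ => e θ) M.init := by
    have hsum (ξ : ℕ → LazyNoise K) : M.regret (fun θ _ => e θ) alg T u ξ =
        ∑ t ∈ Finset.range T, levelCost (run h0 step ξ (t + 1)).2.1 -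
          T * ⨅ θ : Θ, M.avgCost (fun _ => e θ) M.init := by
      rw [MDP.regret]
      congr 1
      refine (lazyBandit_sum_cost _ alg u ξ T).trans (Finset.sum_congr rfl fun t _ => ?_)
      rw [Dynamics.interact_eq_run]
    simp only [hsum]
    have hi (t : ℕ) : Integrable (fun ξ => levelCost (run h0 step ξ (t + 1)).2.1) M.noiseSeq :=
      hint (t + 1) fun h => levelCost h.2.1
    rw [integral_sub (integrable_finsetSum _ fun t _ => hi t) (integrable_const _),
      integral_finsetSum _ fun t _ => hi t]
    simp [ℓ]
  rw [hreg]
  have h1 : 0 ≤ (1 - p) * (ℓ 0 - ℓ T) := mul_nonneg (by linarith) (by linarith)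
  have h2 := htel T
  have h3 : δ / 2 * ∑ t ∈ Finset.range T,
      (1 - playProb arm obs e alg u (lazyNoise p (tilt δ j)) j t) ≤
      ∑ t ∈ Finset.range T, (ℓ (t + 1) - (1 - δ) / 2) :=
    le_of_mul_le_mul_left (by linarith) hp0
  have h5 : ∑ t ∈ Finset.range T, (ℓ (t + 1) - (1 - δ) / 2) =
      ∑ t ∈ Finset.range T, ℓ (t + 1) - T * ((1 - δ) / 2) := by
    simp [Finset.sum_sub_distrib]
  have h4 := mul_le_mul_of_nonneg_left hmin (Nat.cast_nonneg (α := ℝ) T)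
  linarith

end Interaction

/-! ### Lower bounds on the regret -/

section LowerBound

variable {Θ : Type} [MeasurableSpace Θ] {n K : ℕ} {R : Type} [MeasurableSpace R] [Finite R]
  [MeasurableSingletonClass R] {arm : Fin n → Fin K} {obs : LazyNoise K → R} {p δ : ℝ}

/-- Averaging over the good arm and over the seed: if, for every seed, the probabilities of playing
the good arm average to at most `ρ`, then for some good arm the expected regret is at least
`δ / 2 * T * (1 - ρ)`. -/
theorem exists_expectedRegret_ge [MeasurableSingletonClass Θ] [NeZero K] (hp0 : 0 < p)
    (hp1 : p ≤ 1) (hδ0 : 0 ≤ δ) (hδ1 : δ < 1) (e : Θ ≃ Fin n) (harm : Function.Surjective arm)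
    (alg : Algorithm (Bool × R) (Fin n) Θ) (T : ℕ) {ρ : ℝ}
    (hρ : ∀ u, ∑ j, ∑ t ∈ Finset.range T, playProb arm obs e alg u (lazyNoise p (tilt δ j)) j t ≤
      ρ * (K * T)) :
    ∃ j, δ / 2 * T * (1 - ρ) ≤
      (lazyMDP arm obs hp0.le hp1 hδ0 hδ1 j).expectedRegret (fun θ _ => e θ) alg T := by
  have : Finite Θ := Finite.of_equiv _ e.symm
  let M := lazyMDP arm obs hp0.le hp1 hδ0 hδ1
  have hprob (j) : IsProbabilityMeasure (M j).noiseSeq := by unfold MDP.noiseSeq; infer_instance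
  have hint (j) := (M j).integrable_regret (π := fun (θ : Θ) _ => e θ) (measurable_of_finite _)
    alg T
  have hsum : K * (δ / 2 * T * (1 - ρ)) ≤
      ∑ j, (M j).expectedRegret (fun θ _ => e θ) alg T := by
    have h1 (j) : (M j).expectedRegret (fun θ _ => e θ) alg T =
        ∫ u, ∫ ξ, (M j).regret (fun θ _ => e θ) alg T u ξ ∂(M j).noiseSeq ∂alg.law :=
      integral_prod _ (hint j)
    simp only [h1]
    rw [← integral_finsetSum _ fun j _ => (hint j).integral_prod_left]
    have h2 : K * (δ / 2 * T * (1 - ρ)) =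
        ∫ _, K * (δ / 2 * T * (1 - ρ)) ∂alg.law := by simp
    rw [h2]
    refine integral_mono (integrable_const _)
      (integrable_finsetSum _ fun j _ => (hint j).integral_prod_left) fun u => ?_
    refine le_trans ?_ (Finset.sum_le_sum fun j _ =>
      sum_playProb_le_integral_regret hp0 hp1 hδ0 hδ1 j e harm alg u T)
    rw [← Finset.mul_sum]
    simp only [Finset.sum_sub_distrib, Finset.sum_const, Finset.card_range, Finset.card_univ,
      Fintype.card_fin, nsmul_eq_mul, mul_one]
    have := mul_le_mul_of_nonneg_left (hρ u) (div_nonneg hδ0 zero_le_two)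
    linarith
  by_contra! hlt
  have := Finset.sum_lt_sum_of_nonempty (Finset.univ_nonempty (α := Fin K)) fun j _ => hlt j
  simp only [Finset.sum_const, Finset.card_univ, Fintype.card_fin, nsmul_eq_mul] at this
  exact absurd hsum (not_le.2 this)

theorem sum_playProb (e : Θ → Fin n) (alg : Algorithm (Bool × R) (Fin n) Θ) (u : alg.Seed)
    (ν : Measure (LazyNoise K)) [IsProbabilityMeasure ν] (t : ℕ) :
    ∑ j, playProb arm obs e alg u ν j t = 1 := by
  unfold playProb
  rw [← integral_finsetSum]
  · simp
  · intro j _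
    exact integrable_of_dependsOn (dependsOn_run (𝓗 := fun t => (Fin t → Transition (Bool × R)
      (Fin n)) × (Bool × R)) t fun h => if arm (e (alg.choose t u h.1 h.2)) = j then (1 : ℝ) else 0)
      _

theorem playProb_le_one (e : Θ → Fin n) (alg : Algorithm (Bool × R) (Fin n) Θ) (u : alg.Seed)
    (ν : Measure (LazyNoise K)) [IsProbabilityMeasure ν] (j : Fin K) (t : ℕ) :
    playProb arm obs e alg u ν j t ≤ 1 := by
  rw [← sum_playProb (arm := arm) (obs := obs) e alg u ν t]
  refine Finset.single_le_sum (f := fun j => playProb arm obs e alg u ν j t) (fun i _ => ?_)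
    (Finset.mem_univ j)
  exact integral_nonneg fun ξ => by simp only [Pi.zero_apply]; split_ifs <;> norm_num

/-- Without side observations, only the effective plays of arm `j` tell whether it is the good
one. -/
theorem playProb_le_of_bandit (hp0 : 0 < p) (hp1 : p ≤ 1) (hδ0 : 0 ≤ δ) (hδ1 : δ ≤ 1 / 2)
    [NeZero K] (e : Θ → Fin n) (alg : Algorithm (Bool × Unit) (Fin n) Θ) (u : alg.Seed)
    (j : Fin K) (t : ℕ) :
    playProb arm (fun _ => ()) e alg u (lazyNoise p (tilt δ j)) j t ≤
      playProb arm (fun _ => ()) e alg u (lazyNoise p fun _ => 1) j t +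
        8 * (p * δ ^ 2 * ∑ i ∈ Finset.range t,
          playProb arm (fun _ => ()) e alg u (lazyNoise p fun _ => 1) j i) + 1 / 8 := by
  have hδ1' : δ < 1 := by linarith
  have := isProbabilityMeasure_lazyNoise hp0.le hp1 hδ0 hδ1' j
  have := isProbabilityMeasure_lazyNoise_one (K := K) hp0.le hp1
  let 𝓗 : ℕ → Type := fun t => (Fin t → Transition (Bool × Unit) (Fin n)) × (Bool × Unit)
  let h0 : 𝓗 0 := (Fin.elim0, (lazyBandit arm fun _ => ()).init)
  let step : ∀ t, 𝓗 t → LazyNoise K → 𝓗 (t + 1) :=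
    (lazyBandit arm fun _ => ()).interactStep (fun θ _ => e θ) alg u
  let plays : ∀ t, 𝓗 t → ℝ := fun t h => if arm (e (alg.choose t u h.1 h.2)) = j then 1 else 0
  let ℓ : ∀ t, 𝓗 t → LazyNoise K → ℝ := fun t h x =>
    if arm (e (alg.choose t u h.1 h.2)) = j then tilt δ j x else 1
  have hpos : ∀ t h x, 0 < ℓ t h x := by
    intro t h x
    simp only [ℓ]
    split_ifs
    · exact tilt_pos hδ0 hδ1' j x
    · exact one_pos
  have hℓ : ∀ t h (φ : 𝓗 (t + 1) → ℝ), ∫ x, φ (step t h x) ∂(lazyNoise p (tilt δ j)) =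
      ∫ x, ℓ t h x * φ (step t h x) ∂(lazyNoise p fun _ => 1) := by
    intro t h φ
    by_cases hj : arm (e (alg.choose t u h.1 h.2)) = j
    · simp only [ℓ, if_pos hj]
      exact integral_lazyNoise_tilt hp0.le hp1 hδ0 hδ1' j _
    · simp only [ℓ, if_neg hj, one_mul]
      refine integral_lazyNoise_tilt_of_invariant hp0.le hp1 hδ0 hδ1' fun x => ?_
      simp [step, Dynamics.interactStep, lazyBandit, hj]
  refine (integral_run_le_add_entropy (h0 := h0) hpos hℓ (f := plays t)
    (fun h => by simp only [plays]; split_ifs <;> norm_num)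
    (fun h => by simp only [plays]; split_ifs <;> norm_num)).trans ?_
  have hent : -∫ ξ, Real.log (likelihood h0 step ℓ ξ t)
      ∂(Measure.infinitePi fun _ : ℕ => lazyNoise p fun _ => 1) ≤
      p * δ ^ 2 * ∑ i ∈ Finset.range t,
        playProb arm (fun _ => ()) e alg u (lazyNoise p fun _ => 1) j i := by
    rw [integral_log_likelihood hpos, ← Finset.sum_neg_distrib, Finset.mul_sum]
    refine Finset.sum_le_sum fun i _ => ?_
    rw [← integral_neg, playProb, ← integral_const_mul]
    refine integral_mono (integrable_of_dependsOn (dependsOn_run i fun h : 𝓗 i =>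
      -∫ x, Real.log (ℓ i h x) ∂(lazyNoise p fun _ => 1)) _)
      (integrable_of_dependsOn (dependsOn_run i fun h => p * δ ^ 2 * plays i h) _) fun ξ => ?_
    change -∫ x, Real.log (ℓ i (run h0 step ξ i) x) ∂(lazyNoise p fun _ => 1) ≤
      p * δ ^ 2 * plays i (run h0 step ξ i)
    simp only [ℓ, plays]
    split_ifs
    · rw [mul_one]; exact neg_integral_log_tilt_le hp0.le hp1 hδ0 hδ1 j
    · simp
  exact add_le_add_left (add_le_add_right (mul_le_mul_of_nonneg_left hent (by norm_num)) _) _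

theorem playProb_le_second_moment (hp0 : 0 < p) (hp1 : p ≤ 1) (hδ0 : 0 ≤ δ) (hδ1 : δ < 1)
    [NeZero K] (e : Θ → Fin n) (alg : Algorithm (Bool × R) (Fin n) Θ) (u : alg.Seed)
    (j : Fin K) (t : ℕ) {α : ℝ} (hα : 0 < α) :
    playProb arm obs e alg u (lazyNoise p (tilt δ j)) j t ≤
      (α * (1 + p * δ ^ 2) ^ t +
        playProb arm obs e alg u (lazyNoise p fun _ => 1) j t / α) / 2 := by
  have := isProbabilityMeasure_lazyNoise hp0.le hp1 hδ0 hδ1 j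
  have := isProbabilityMeasure_lazyNoise_one (K := K) hp0.le hp1
  refine integral_run_le_second_moment
    (𝓗 := fun t => (Fin t → Transition (Bool × R) (Fin n)) × (Bool × R))
    (h0 := (Fin.elim0, (lazyBandit arm obs).init))
    (step := (lazyBandit arm obs).interactStep (fun θ _ => e θ) alg u)
    (ℓ := fun _ _ x => tilt δ j x)
    (f := fun h => if arm (e (alg.choose t u h.1 h.2)) = j then (1 : ℝ) else 0)
    (fun t h φ => integral_lazyNoise_tilt hp0.le hp1 hδ0 hδ1 j _)
    (fun _ _ => integral_tilt_sq hp0.le hp1 j) hα fun h => ?_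
  split_ifs <;> norm_num

/-- The bandit lower bound. For `δ² = K / (64 p T)` the relative entropies for the `K` positions of
the good arm average to at most `1 / 64`, so that the good arm is played with average probability at
most `1 / K + 1 / 4 ≤ 3 / 4`. -/
theorem exists_expectedRegret_ge_of_bandit [MeasurableSingletonClass Θ] (hK : 2 ≤ K) (hp0 : 0 < p)
    (hp1 : p ≤ 1) (e : Θ ≃ Fin n) (harm : Function.Surjective arm) {T : ℕ} (hT : K ≤ p * T)
    (alg : Algorithm (Bool × Unit) (Fin n) Θ) :
    ∃ (δ : ℝ) (hδ0 : 0 ≤ δ) (hδ1 : δ < 1) (j : Fin K), 1 / 64 * √(1 / p * K * T) ≤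
      (lazyMDP arm (fun _ => ()) hp0.le hp1 hδ0 hδ1 j).expectedRegret (fun θ _ => e θ) alg T := by
  have : NeZero K := ⟨by omega⟩
  have hK' : (2 : ℝ) ≤ K := by exact_mod_cast hK
  have hT0 : (0 : ℝ) < T := by
    by_contra h
    nlinarith [mul_nonneg hp0.le (not_lt.1 h |> neg_nonneg.2)]
  have hpT : 0 < p * T := mul_pos hp0 hT0
  set δ := √(K / (64 * (p * T))) with hδ
  have hδ0 : 0 ≤ δ := Real.sqrt_nonneg _
  have hδsq : δ ^ 2 = K / (64 * (p * T)) := Real.sq_sqrt (by positivity)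
  have hδ2 : δ ≤ 1 / 2 := by
    refine Real.sqrt_le_iff.2 ⟨by norm_num, ?_⟩
    rw [div_le_iff₀ (by positivity)]
    linarith
  have hδ1 : δ < 1 := by linarith
  have hρ (u) : ∑ j, ∑ t ∈ Finset.range T,
      playProb arm (fun _ => ()) e alg u (lazyNoise p (tilt δ j)) j t ≤ 3 / 4 * (K * T) := by
    have := isProbabilityMeasure_lazyNoise_one (K := K) hp0.le hp1
    have hsum (t : ℕ) (ht : t ∈ Finset.range T) :
        ∑ j, playProb arm (fun _ => ()) e alg u (lazyNoise p (tilt δ j)) j t ≤ 1 + K / 4 := by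
      refine (Finset.sum_le_sum fun j _ =>
        playProb_le_of_bandit hp0 hp1 hδ0 hδ2 e alg u j t).trans ?_
      rw [Finset.sum_add_distrib, Finset.sum_add_distrib, sum_playProb, ← Finset.mul_sum,
        ← Finset.mul_sum, Finset.sum_comm]
      simp only [sum_playProb, Finset.sum_const, Finset.card_range, Finset.card_univ,
        Fintype.card_fin, nsmul_eq_mul, mul_one]
      have ht' : (t : ℝ) ≤ T := by exact_mod_cast (Finset.mem_range.1 ht).le
      have h1 : p * δ ^ 2 * t ≤ p * δ ^ 2 * T := mul_le_mul_of_nonneg_left ht' (by positivity)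
      have h2 : p * δ ^ 2 * T = K / 64 := by rw [hδsq]; field_simp
      linarith
    rw [Finset.sum_comm]
    refine (Finset.sum_le_sum hsum).trans ?_
    simp only [Finset.sum_const, Finset.card_range, nsmul_eq_mul]
    nlinarith
  obtain ⟨j, hj⟩ := exists_expectedRegret_ge hp0 hp1 hδ0 hδ1 e harm alg T hρ
  refine ⟨δ, hδ0, hδ1, j, le_trans ?_ hj⟩
  have : √(1 / p * K * T) ≤ 8 * (δ * T) := by
    refine Real.sqrt_le_iff.2 ⟨by positivity, le_of_eq ?_⟩
    rw [mul_pow, mul_pow, hδsq]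
    field_simp
    norm_num
  linarith

/-- The lower bound for prediction with `K` experts; it holds for every side observation `obs`. For
`δ² = log K / (2 p T)` the likelihood ratios have second moment at most `√K`, so that the good arm
is played with average probability at most `7 / 8` if `K ≥ 2`. -/
theorem exists_expectedRegret_ge_log [MeasurableSingletonClass Θ] [NeZero K] (hp0 : 0 < p)
    (hp1 : p ≤ 1) (e : Θ ≃ Fin n) (harm : Function.Surjective arm) {T : ℕ} (hT0 : 0 < T)
    (hT : Real.log K ≤ p * T) (alg : Algorithm (Bool × R) (Fin n) Θ) :
    ∃ (δ : ℝ) (hδ0 : 0 ≤ δ) (hδ1 : δ < 1) (j : Fin K), 1 / 64 * √(1 / p * Real.log K * T) ≤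
      (lazyMDP arm obs hp0.le hp1 hδ0 hδ1 j).expectedRegret (fun θ _ => e θ) alg T := by
  have hT0' : (0 : ℝ) < T := by exact_mod_cast hT0
  have hpT : 0 < p * T := mul_pos hp0 hT0'
  have hlog : 0 ≤ Real.log K := Real.log_natCast_nonneg K
  have hK0 : (0 : ℝ) < K := by exact_mod_cast Nat.pos_of_ne_zero (NeZero.ne K)
  set δ := √(Real.log K / (2 * (p * T))) with hδ
  have hδ0 : 0 ≤ δ := Real.sqrt_nonneg _
  have hδsq : δ ^ 2 = Real.log K / (2 * (p * T)) := Real.sq_sqrt (by positivity)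
  have hδ1 : δ < 1 := by
    rw [hδ, Real.sqrt_lt' one_pos, div_lt_iff₀ (by positivity)]
    linarith
  rcases Nat.lt_or_ge K 2 with hK | hK
  -- With a single arm the claimed bound is zero.
  · have hK1 : K = 1 := by have := NeZero.ne K; omega
    have hl : Real.log K = 0 := by simp [hK1]
    have hρ (u) : ∑ j, ∑ t ∈ Finset.range T,
        playProb arm obs e alg u (lazyNoise p (tilt δ j)) j t ≤ 1 * (K * T) := by
      refine (Finset.sum_le_sum fun j _ => Finset.sum_le_sum fun t _ => ?_).trans
        (b := ∑ _ : Fin K, ∑ _ ∈ Finset.range T, (1 : ℝ)) (by simp)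
      have := isProbabilityMeasure_lazyNoise hp0.le hp1 hδ0 hδ1 j
      exact playProb_le_one e alg u _ j t
    obtain ⟨j, hj⟩ := exists_expectedRegret_ge hp0 hp1 hδ0 hδ1 e harm alg T hρ
    refine ⟨δ, hδ0, hδ1, j, le_trans ?_ hj⟩
    simp [hl]
  have hK' : (2 : ℝ) ≤ K := by exact_mod_cast hK
  have hρ (u) : ∑ j, ∑ t ∈ Finset.range T,
      playProb arm obs e alg u (lazyNoise p (tilt δ j)) j t ≤ 7 / 8 * (K * T) := by
    have := isProbabilityMeasure_lazyNoise_one (K := K) hp0.le hp1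
    have hr2 : √(K : ℝ) ^ 2 = K := Real.sq_sqrt hK0.le
    have hr : 4 / 3 ≤ √(K : ℝ) := Real.le_sqrt_of_sq_le (by norm_num; linarith)
    have hpow (t : ℕ) (ht : t ∈ Finset.range T) : (1 + p * δ ^ 2) ^ t ≤ √(K : ℝ) := by
      have h1 : (1 : ℝ) ≤ 1 + p * δ ^ 2 := by nlinarith [mul_nonneg hp0.le (sq_nonneg δ)]
      calc (1 + p * δ ^ 2) ^ t ≤ (1 + p * δ ^ 2) ^ T :=
            pow_le_pow_right₀ h1 (Finset.mem_range.1 ht).le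
        _ ≤ Real.exp (p * δ ^ 2) ^ T :=
            pow_le_pow_left₀ (by linarith) (by linarith [Real.add_one_le_exp (p * δ ^ 2)]) T
        _ = √(K : ℝ) := by
            rw [← Real.exp_nat_mul, hδsq, Real.sqrt_eq_rpow, Real.rpow_def_of_pos hK0]
            congr 1
            field_simp
    have hsum (t : ℕ) (ht : t ∈ Finset.range T) :
        ∑ j, playProb arm obs e alg u (lazyNoise p (tilt δ j)) j t ≤ 7 / 8 * K := by
      -- The value of `α` roughly balances the two terms of the second-moment bound at `K = 2`.
      have hα : (0 : ℝ) < 5 / (4 * K) := by positivity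
      refine (Finset.sum_le_sum fun j _ =>
        playProb_le_second_moment hp0 hp1 hδ0 hδ1 e alg u j t hα).trans ?_
      rw [← Finset.sum_div, Finset.sum_add_distrib, ← Finset.sum_div, sum_playProb]
      simp only [Finset.sum_const, Finset.card_univ, Fintype.card_fin, nsmul_eq_mul]
      have h1 : (K : ℝ) * (5 / (4 * K) * (1 + p * δ ^ 2) ^ t) =
          5 / 4 * (1 + p * δ ^ 2) ^ t := by field_simp
      have h2 : 1 / (5 / (4 * K)) = 4 / 5 * (K : ℝ) := by field_simp
      rw [h1, h2]
      nlinarith [hpow t ht]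
    rw [Finset.sum_comm]
    refine (Finset.sum_le_sum hsum).trans ?_
    simp only [Finset.sum_const, Finset.card_range, nsmul_eq_mul]
    linarith
  obtain ⟨j, hj⟩ := exists_expectedRegret_ge hp0 hp1 hδ0 hδ1 e harm alg T hρ
  refine ⟨δ, hδ0, hδ1, j, le_trans ?_ hj⟩
  have : √(1 / p * Real.log K * T) ≤ 4 * (δ * T) := by
    refine Real.sqrt_le_iff.2 ⟨by positivity, ?_⟩
    rw [mul_pow, mul_pow, hδsq]
    have : (4 : ℝ) ^ 2 * (Real.log K / (2 * (p * T)) * T ^ 2) =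
        8 * (1 / p * Real.log K * T) := by field_simp; ring
    rw [this]
    have : 0 ≤ 1 / p * Real.log K * T := by positivity
    linarith
  linarith

end LowerBound

/-! ### The parameter set and the regret lower bound -/

section Parameters

/-- The parameters `0, …, n - 1` on the real line. -/
noncomputable def gridParameters (n : ℕ) : Finset (Fin 1 → ℝ) :=
  Finset.univ.map
    ⟨fun (i : Fin n) (_ : Fin 1) => ((i : ℕ) : ℝ), fun i j h => by
      simpa [Fin.ext_iff] using congrFun h 0⟩

theorem card_gridParameters (n : ℕ) : (gridParameters n).card = n := by
  simp [gridParameters]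

theorem one_le_dist_gridParameters {n : ℕ} (θ θ' : gridParameters n) (h : θ ≠ θ') :
    1 ≤ dist θ θ' := by
  obtain ⟨θ, hθ⟩ := θ
  obtain ⟨θ', hθ'⟩ := θ'
  simp only [gridParameters, Finset.mem_map, Finset.mem_univ, true_and] at hθ hθ'
  obtain ⟨i, rfl⟩ := hθ
  obtain ⟨j, rfl⟩ := hθ'
  have hij : (i : ℕ) ≠ j := fun hij => h (by obtain rfl := Fin.ext hij; rfl)
  refine le_trans ?_ (dist_le_pi_dist (fun _ : Fin 1 => ((i : ℕ) : ℝ)) (fun _ => ((j : ℕ) : ℝ)) 0)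
  rw [Nat.dist_cast_real, Nat.dist_eq]
  have : (1 : ℤ) ≤ |(i : ℤ) - (j : ℤ)| := Int.one_le_abs (by omega)
  exact_mod_cast this

theorem boundedAssumption {d : ℕ} (Θ : Finset (Fin d → ℝ)) : BoundedAssumption Θ :=
  Θ.finite_toSet.isBounded.exists_norm_le

theorem exists_surjective_fin {w n : ℕ} (hw : 1 ≤ w) (hn : w ≤ n) :
    ∃ f : Fin n → Fin w, Function.Surjective f := by
  have : NeZero w := ⟨by omega⟩
  exact ⟨fun i => Fin.ofNat w i, fun j => ⟨j.castLE hn, by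
    ext; simp [Fin.ofNat, Nat.mod_eq_of_lt j.2]⟩⟩

end Parameters

theorem mainTheorem2 :
    ∃ c : ℝ, 0 < c ∧
      ∀ (w n : ℕ) (H : ℝ), 1 ≤ w → w ≤ n → 0 < H → H ≤ n →
        ∃ (S A Ξ : Type) (_ : Finite S) (_ : Finite A) (_ : Finite Ξ)
          (_ : MeasurableSpace S) (_ : MeasurableSpace A) (_ : MeasurableSpace Ξ)
          (_ : MeasurableSingletonClass S) (_ : MeasurableSingletonClass A)
          (_ : MeasurableSingletonClass Ξ)
          (d : ℕ) (Θ : Finset (Fin d → ℝ)) (π : Θ → S → A) (E : Dynamics S A Ξ),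
          Θ.card = n ∧ Function.Injective π ∧ BoundedAssumption Θ ∧
          IsPreorder Θ (E.SamplePathLE π) ∧ HasWidth (E.SamplePathLE π) w ∧
          ∀ T : ℕ, max 1 H * max 1 (complexity w n) ≤ T →
            ∀ alg : Algorithm S A Θ,
              ∃ M : MDP S A Ξ, M.toDynamics = E ∧
                M.RestartAssumption π ∧ M.GainBiasAssumption π H ∧
                c * √(H * complexity w n * T) ≤ M.expectedRegret π alg T := by
  refine ⟨1 / 64, by norm_num, fun w n H hw hn hH _ => ?_⟩
  let e : gridParameters n ≃ Fin n := Finset.equivFinOfCardEq (card_gridParameters n)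
  have hne : Nonempty (gridParameters n) := ⟨e.symm ⟨0, by omega⟩⟩
  -- Actions take effect with this probability, so that the bias has span `1 / p - 1 ≤ H`.
  set p : ℝ := 1 / max 1 H with hp
  have hmax : (1 : ℝ) ≤ max 1 H := le_max_left _ _
  have hp0 : 0 < p := by positivity
  have hp1 : p ≤ 1 := by rw [hp, div_le_one (by positivity)]; exact hmax
  have hpinv : 1 / p = max 1 H := by rw [hp, one_div_one_div]
  have hHp : H ≤ 1 / p := hpinv ▸ le_max_right _ _
  have hspan : 1 / p - 1 ≤ H := by
    rw [hpinv, sub_le_iff_le_add]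
    exact max_le (by linarith) (by linarith)
  have hTp {T : ℕ} (hT : max 1 H * max 1 (complexity w n) ≤ T) :
      max 1 (complexity w n) ≤ p * T := by
    rw [hp, one_div, ← div_eq_inv_mul, le_div_iff₀ (by positivity)]
    linarith
  have hmono (B : ℝ) (hB : 0 ≤ B) (T : ℕ) : 1 / 64 * √(H * B * T) ≤ 1 / 64 * √(1 / p * B * T) := by
    gcongr
  have hinj (R : Type) [Nonempty R] :
      Function.Injective fun (θ : gridParameters n) (_ : Bool × R) => e θ := fun θ θ' h =>
    e.injective (congrFun h (Classical.arbitrary _))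
  have : NeZero n := ⟨by omega⟩
  by_cases hw1 : w = 1
  · have hrel (θ' θ : gridParameters n) :
        (lazyBandit (n := n) (K := n) id id).SamplePathLE (fun θ _ => e θ) θ' θ ↔ () = () :=
      iff_of_true (Dynamics.samplePathLE_of_revealing _ (read := Prod.snd) measurable_snd
        (fun _ _ _ => rfl) _ θ' θ) rfl
    refine ⟨Bool × LazyNoise n, Fin n, LazyNoise n, inferInstance, inferInstance, inferInstance,
      inferInstance, inferInstance, inferInstance, inferInstance, inferInstance, inferInstance, 1,
      gridParameters n, fun θ _ => e θ, lazyBandit id id, card_gridParameters n, hinj _,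
      boundedAssumption _, isPreorder_of_iff_eq (fun _ => ()) hrel, ?_, fun T hT alg => ?_⟩
    · rw [hw1]
      exact hasWidth_of_iff_eq (f := fun _ => ())
        (fun _ => ⟨Classical.arbitrary _, rfl⟩) hrel
    · have hB : complexity w n = Real.log n := if_pos hw1
      have h := hTp hT
      rw [hB] at h ⊢
      have hT0 : 0 < T := by
        rw [Nat.pos_iff_ne_zero]
        rintro rfl
        simp only [Nat.cast_zero, mul_zero] at h
        linarith [le_max_left 1 (Real.log n)]
      obtain ⟨δ, hδ0, hδ1, j, hj⟩ := exists_expectedRegret_ge_log (arm := id) (obs := id) hp0 hp1 e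
        Function.surjective_id hT0 ((le_max_right _ _).trans h) alg
      exact ⟨lazyMDP id id hp0.le hp1 hδ0 hδ1 j, rfl, restartAssumption_lazyMDP hp0 hp1 hδ0 hδ1 j _,
        gainBiasAssumption_lazyMDP hp0 hp1 hδ0 hδ1 j e one_le_dist_gridParameters hspan,
        (hmono _ (Real.log_natCast_nonneg n) T).trans hj⟩
  · obtain ⟨arm, harm⟩ := exists_surjective_fin hw hn
    have hrel := lazyBandit_samplePathLE_iff (arm := arm) e
    refine ⟨Bool × Unit, Fin n, LazyNoise w, inferInstance, inferInstance, inferInstance,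
      inferInstance, inferInstance, inferInstance, inferInstance, inferInstance, inferInstance, 1,
      gridParameters n, fun θ _ => e θ, lazyBandit arm fun _ => (), card_gridParameters n, hinj _,
      boundedAssumption _, isPreorder_of_iff_eq (fun θ => arm (e θ)) hrel, ?_, fun T hT alg => ?_⟩
    · have := hasWidth_of_iff_eq (f := fun θ => arm (e θ)) (harm.comp e.surjective) hrel
      rwa [Fintype.card_fin] at this
    · have hB : complexity w n = w := if_neg hw1
      have h := hTp hT
      rw [hB] at h ⊢
      obtain ⟨δ, hδ0, hδ1, j, hj⟩ := exists_expectedRegret_ge_of_bandit (by omega) hp0 hp1 e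
        harm ((le_max_right _ _).trans h) alg
      exact ⟨lazyMDP arm (fun _ => ()) hp0.le hp1 hδ0 hδ1 j, rfl,
        restartAssumption_lazyMDP hp0 hp1 hδ0 hδ1 j _,
        gainBiasAssumption_lazyMDP hp0 hp1 hδ0 hδ1 j e one_le_dist_gridParameters hspan,
        (hmono _ (Nat.cast_nonneg w) T).trans hj⟩
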